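/- Let $n\in\{2,3\}$ and let $\Omega\subset\mathbb R^n$ be a bounded open set with boundary of class $C^2$ and outward unit normal $\mathbf n$. Let $\Gamma(x)=-\frac1{2\pi}\log|x|$ if $n=2$ and $\Gamma(x)=\frac1{4\pi|x|}$ if $n=3$, so that $-\Delta\Gamma=\delta_0$. Let $\mathcal G_D$ be the Dirichlet Green's function of $\Omega$: for $x\in\Omega$, $\mathcal G_D(x,\cdot)=\Gamma(x-\cdot)+h_x$ with $h_x$ harmonic in $\Omega$ and continuous on $\overline\Omega$, and $\mathcal G_D(x,y)=0$ if one of $x,y$ lies on $\partial\Omega$ and the other in $\Omega$. A Neumann Green's function $\mathcal G_N$ of $\Omega$ is a function such that, for $x\in\Omega$, $\mathcal G_N(x,\cdot)=\Gamma(x-\cdot)+k_x$ with $k_x$ harmonic in $\Omega$ and $C^1$ on $\overline\Omega$, and $\partial\mathcal G_N(x,\cdot)/\partial\mathbf n=-1/|\partial\Omega|$ on $\partial\Omega$. Put $\mathcal K=\mathcal G_D-\mathcal G_N$. Let $N(\mathcal K)$ denote the space of functions $Y\in L^\infty(\Omega)$ orthogonal to the harmonic functions, i.e. $\int_\Omega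 uY=0$ for every $u\in C(\overline\Omega)$ harmonic in $\Omega$. **Lemma.** Let $Y_k\in N(\mathcal K)$. Then the integral $\Phi_k(x)=\int_\Omega\mathcal G_D(x,y)Y_k(y)\,dy$ converges for all $x\in\overline\Omega$, $\Phi_k$ is of class $C^1$ on $\overline\Omega$, and: (i) $\Delta\Phi_k=-Y_k$ in $\Omega$ in the sense of distributions; moreover, on every open $U\subseteq\Omega$ on which $Y_k$ is $C^1$, $\Phi_k$ is $C^2$ and the equation holds pointwise; (ii) $\Phi_k=0$ on $\partial\Omega$; (iii) $\partial\Phi_k/\partial\mathbf n=0$ on $\partial\Omega$. In addition, for every Neumann Green's function $\mathcal G_N$ and every $x\in\Omega$, the integral $\int_\Omega\mathcal G_N(x,y)Y_k(y)\,dy$ converges and equals $\Phi_k(x)$; equivalently, $\int_\Omega\mathcal K(x,y)Y_k(y)\,dy=0$. -/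

import Mathlib

open MeasureTheory Set Topology
open scoped ContDiff Laplacian

noncomputable section

/-- `ρ` is a `C²` defining function of `Ω` on the open neighbourhood `U` of the boundary point
`x`: near `x` the set `Ω` is `{ρ < 0}`, and `ρ` has non-zero gradient at `x`. -/
structure IsC2DefiningFunction {n : ℕ} (Ω : Set (EuclideanSpace ℝ (Fin n)))
    (x : EuclideanSpace ℝ (Fin n)) (U : Set (EuclideanSpace ℝ (Fin n)))
    (ρ : EuclideanSpace ℝ (Fin n) → ℝ) : Prop where
  isOpen : IsOpen U
  mem : x ∈ U
  contDiffOn : ContDiffOn ℝ 2 ρ U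
  apply_eq_zero : ρ x = 0
  gradient_ne_zero : gradient ρ x ≠ 0
  inter_eq : Ω ∩ U = {y ∈ U | ρ y < 0}

/-- A bounded open set with boundary of class `C²`. -/
structure IsBoundedC2Domain {n : ℕ} (Ω : Set (EuclideanSpace ℝ (Fin n))) : Prop where
  isOpen : IsOpen Ω
  isBounded : Bornology.IsBounded Ω
  exists_defining : ∀ x ∈ frontier Ω, ∃ U ρ, IsC2DefiningFunction Ω x U ρ

/-- `ν` is the outward unit normal of `Ω` at the boundary point `x`: the normalized gradient of a
defining function. -/
def IsOutwardUnitNormal {n : ℕ} (Ω : Set (EuclideanSpace ℝ (Fin n)))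
    (x ν : EuclideanSpace ℝ (Fin n)) : Prop :=
  ∃ U ρ, IsC2DefiningFunction Ω x U ρ ∧ ν = ‖gradient ρ x‖⁻¹ • gradient ρ x

/-- The function `u`, given on the closure of `Ω`, has outward normal derivative `c` at the
boundary point `x`: the derivative at `t = 0` of `t ↦ u (x + t ν)`, `t ≤ 0`, is `c`. -/
def HasNormalDerivAt {n : ℕ} (Ω : Set (EuclideanSpace ℝ (Fin n)))
    (u : EuclideanSpace ℝ (Fin n) → ℝ) (c : ℝ) (x : EuclideanSpace ℝ (Fin n)) : Prop :=
  ∀ ν, IsOutwardUnitNormal Ω x ν → HasDerivWithinAt (fun t : ℝ => u (x + t • ν)) c (Iic 0) 0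

/-- `u ∈ C¹(closure Ω)`: `u` is continuous on the closure, differentiable in `Ω`, and its gradient
extends continuously to the closure. -/
def IsC1OnClosure {n : ℕ} (Ω : Set (EuclideanSpace ℝ (Fin n)))
    (u : EuclideanSpace ℝ (Fin n) → ℝ) : Prop :=
  ContinuousOn u (closure Ω) ∧
    ∃ g : EuclideanSpace ℝ (Fin n) → EuclideanSpace ℝ (Fin n),
      ContinuousOn g (closure Ω) ∧ ∀ x ∈ Ω, HasGradientAt u (g x) x

/-- The surface measure `|∂Ω|` of the boundary: the `(n - 1)`-dimensional Hausdorff measure,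
normalized to agree with Lebesgue measure on hyperplanes. -/
def boundaryArea {n : ℕ} (Ω : Set (EuclideanSpace ℝ (Fin n))) : ℝ :=
  (μHE[n - 1] : Measure (EuclideanSpace ℝ (Fin n))).real (frontier Ω)

/-- The fundamental solution `Γ` of the Laplacian, `-ΔΓ = δ₀`, in dimensions two and three
(only `n = 2` and `n = 3` are used). -/
def fundSol {n : ℕ} (x : EuclideanSpace ℝ (Fin n)) : ℝ :=
  if n = 2 then -(2 * Real.pi)⁻¹ * Real.log ‖x‖ else (4 * Real.pi * ‖x‖)⁻¹

/-- `G` is the Dirichlet Green's function of `Ω`: for every `x ∈ Ω`, `G(x, ·)` is the sum of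
`Γ(x - ·)` and of a function that is harmonic in `Ω` and continuous on the closure, and `G` vanishes
when one of its arguments lies in `Ω` and the other one on the boundary. -/
structure IsDirichletGreen {n : ℕ} (Ω : Set (EuclideanSpace ℝ (Fin n)))
    (G : EuclideanSpace ℝ (Fin n) → EuclideanSpace ℝ (Fin n) → ℝ) : Prop where
  regular_part : ∀ x ∈ Ω, ∃ h : EuclideanSpace ℝ (Fin n) → ℝ,
    InnerProductSpace.HarmonicOnNhd h Ω ∧ ContinuousOn h (closure Ω) ∧
      ∀ y ∈ closure Ω, y ≠ x → G x y = fundSol (x - y) + h y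
  right_boundary : ∀ x ∈ Ω, ∀ y ∈ frontier Ω, G x y = 0
  left_boundary : ∀ x ∈ frontier Ω, ∀ y ∈ Ω, G x y = 0

/-- `G` is a Neumann Green's function of `Ω`: for every `x ∈ Ω`, `G(x, ·)` is the sum of
`Γ(x - ·)` and of a function that is harmonic in `Ω` and of class `C¹` on the closure, and its
normal derivative is `-1/|∂Ω|` on the boundary. This leaves an additive constant, depending on `x`,
free; no normalization is imposed. -/
structure IsNeumannGreen {n : ℕ} (Ω : Set (EuclideanSpace ℝ (Fin n)))
    (G : EuclideanSpace ℝ (Fin n) → EuclideanSpace ℝ (Fin n) → ℝ) : Prop where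
  regular_part : ∀ x ∈ Ω, ∃ h : EuclideanSpace ℝ (Fin n) → ℝ,
    InnerProductSpace.HarmonicOnNhd h Ω ∧ IsC1OnClosure Ω h ∧
      ∀ y ∈ closure Ω, y ≠ x → G x y = fundSol (x - y) + h y
  normal_deriv : ∀ x ∈ Ω, ∀ y ∈ frontier Ω,
    HasNormalDerivAt Ω (fun z => G x z) (-1 / boundaryArea Ω) y

/-- The kernel `𝒦 = G_D - G_N`. -/
def greenDiff {n : ℕ} (GD GN : EuclideanSpace ℝ (Fin n) → EuclideanSpace ℝ (Fin n) → ℝ)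
    (x y : EuclideanSpace ℝ (Fin n)) : ℝ :=
  GD x y - GN x y

/-- The null space `N(𝒦)`: the essentially bounded functions on `Ω` that are orthogonal to all
harmonic functions in `Ω` (continuous on the closure, so that the integral makes sense). -/
def nullSpace {n : ℕ} (Ω : Set (EuclideanSpace ℝ (Fin n))) :
    Set (EuclideanSpace ℝ (Fin n) → ℝ) :=
  {Y | MemLp Y ⊤ (volume.restrict Ω) ∧
    ∀ u : EuclideanSpace ℝ (Fin n) → ℝ, InnerProductSpace.HarmonicOnNhd u Ω →
      ContinuousOn u (closure Ω) → ∫ y in Ω, u y * Y y = 0}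

/-- The potential `Φ(x) = ∫_Ω G(x, y) Y(y) dy`. -/
def greenPotential {n : ℕ} (Ω : Set (EuclideanSpace ℝ (Fin n)))
    (G : EuclideanSpace ℝ (Fin n) → EuclideanSpace ℝ (Fin n) → ℝ)
    (Y : EuclideanSpace ℝ (Fin n) → ℝ) (x : EuclideanSpace ℝ (Fin n)) : ℝ :=
  ∫ y in Ω, G x y * Y y

end

/-! Everything reduces to the Newtonian potential W(x) = ∫_Ω Γ(x - y) Y(y) dy, defined on the whole
space. For x in Ω both Green's functions differ from Γ(x - ·) by a function harmonic in Ω and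
continuous up to the boundary. Y is orthogonal to that function, so both potentials equal W(x); this
also gives 𝒦Y = 0.

For x outside the closure of Ω, Γ(x - ·) is itself harmonic near the closure, so W(x) = 0
(`newtonPotential_eq_zero`). Since Y is bounded, W is C¹ on the whole space
(`contDiff_one_newtonPotential`). Every point of a C² boundary is a limit of exterior points, so W
and its gradient vanish on ∂Ω by continuity (`newtonPotential_frontier`). This gives (ii) and (iii)
at once.

For (i), -ΔΓ = δ₀ and Fubini give the Poisson equation for W in the sense of distributions
(`integral_newtonPotential_mul_laplacian`). Where Y is C¹, a cutoff argument shows that W is C², and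
the distributional equation becomes pointwise.

The singularity of Γ is handled by replacing ‖x‖² with ‖x‖² + ε. The regularized kernels are smooth,
they and their derivatives are dominated by a locally integrable function uniformly in ε ∈ (0, 1],
and their negative Laplacians form an approximate identity. -/

open Filter Metric

noncomputable section

set_option linter.unusedSectionVars false

/-! ### Potentials with smooth and with singular kernels -/

section KernelPotential

universe u

variable {E F : Type*} [NormedAddCommGroup E] [NormedSpace ℝ E] [FiniteDimensional ℝ E]
  [MeasurableSpace E] [BorelSpace E] [NormedAddCommGroup F] [NormedSpace ℝ F]

/-- The potential `x ↦ ∫_S Y(y) k(x - y) dy` of the density `Y` on `S` with convolution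
kernel `k`. -/
def kernelPotential (μ : Measure E) (S : Set E) (Y : E → ℝ) (k : E → F) (x : E) : F :=
  ∫ y in S, Y y • k (x - y) ∂μ

variable {μ : Measure E} {S : Set E} {Y : E → ℝ} {k : E → F}

theorem exists_norm_sub_le_of_isBounded (hS : Bornology.IsBounded S) (R : ℝ) :
    ∃ R', ∀ x, ‖x‖ ≤ R → ∀ y ∈ S, ‖x - y‖ ≤ R' := by
  obtain ⟨r, hr⟩ := hS.exists_norm_le
  exact ⟨R + r, fun x hx y hy => (norm_sub_le x y).trans (add_le_add hx (hr y hy))⟩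

theorem norm_le_of_mem_ball_one {E : Type*} [SeminormedAddCommGroup E] {x z : E}
    (hz : z ∈ ball x 1) : ‖z‖ ≤ ‖x‖ + 1 := by
  have h1 : ‖z - x‖ < 1 := by simpa [dist_eq_norm] using hz
  linarith [norm_le_norm_add_norm_sub' z x]

theorem exists_bound_continuous_sub (hk : Continuous k) (hS : Bornology.IsBounded S) (R : ℝ) :
    ∃ C, 0 ≤ C ∧ ∀ x, ‖x‖ ≤ R → ∀ y ∈ S, ‖k (x - y)‖ ≤ C := by
  obtain ⟨R', hR'⟩ := exists_norm_sub_le_of_isBounded hS R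
  obtain ⟨C, hC⟩ := (isCompact_closedBall (0 : E) R').exists_bound_of_continuousOn hk.continuousOn
  exact ⟨max C 0, le_max_right _ _, fun x hx y hy => (hC _ (by simpa using hR' x hx y hy)).trans
    (le_max_left _ _)⟩

theorem integrableOn_smul_continuous_sub [SecondCountableTopology F] (hk : Continuous k)
    (hS : Bornology.IsBounded S) (hSm : MeasurableSet S) (hY : IntegrableOn Y S μ) (x : E) :
    IntegrableOn (fun y => Y y • k (x - y)) S μ := by
  obtain ⟨C, -, hC⟩ := exists_bound_continuous_sub hk hS ‖x‖
  refine Integrable.smul_bdd hY C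
    (hk.comp (continuous_const.sub continuous_id)).aestronglyMeasurable ?_
  filter_upwards [ae_restrict_mem hSm] with y hy using hC x le_rfl y hy

theorem hasFDerivAt_kernelPotential (hk : ContDiff ℝ 1 k) [FiniteDimensional ℝ F]
    (hS : Bornology.IsBounded S) (hSm : MeasurableSet S) (hY : IntegrableOn Y S μ) (x : E) :
    HasFDerivAt (kernelPotential μ S Y k) (kernelPotential μ S Y (fderiv ℝ k) x) x := by
  have hk' : Continuous (fderiv ℝ k) := hk.continuous_fderiv one_ne_zero
  obtain ⟨C, hC0, hC⟩ := exists_bound_continuous_sub hk' hS (‖x‖ + 1)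
  refine hasFDerivAt_integral_of_dominated_of_fderiv_le (bound := fun y => ‖Y y‖ * C)
    (F' := fun x y => Y y • fderiv ℝ k (x - y)) (ball_mem_nhds x one_pos)
    (.of_forall fun z => ?_) ?_ ?_ ?_ ?_ ?_
  · exact (integrableOn_smul_continuous_sub hk.continuous hS hSm hY z).aestronglyMeasurable
  · exact integrableOn_smul_continuous_sub hk.continuous hS hSm hY x
  · exact (integrableOn_smul_continuous_sub hk' hS hSm hY x).aestronglyMeasurable
  · filter_upwards [ae_restrict_mem hSm] with y hy z hz
    rw [norm_smul]
    gcongr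
    exact hC z (norm_le_of_mem_ball_one hz) y hy
  · exact hY.norm.mul_const C
  · refine .of_forall fun y z _ => HasFDerivAt.const_smul ?_ (Y y)
    have h1 : HasFDerivAt k (fderiv ℝ k (z - y)) (z - y) :=
      (hk.differentiable one_ne_zero _).hasFDerivAt
    have h2 := h1.comp z ((hasFDerivAt_id z).sub_const y)
    rwa [ContinuousLinearMap.comp_id] at h2

theorem continuous_kernelPotential [FiniteDimensional ℝ F] (hk : Continuous k)
    (hS : Bornology.IsBounded S) (hSm : MeasurableSet S) (hY : IntegrableOn Y S μ) :
    Continuous (kernelPotential μ S Y k) := by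
  refine continuous_iff_continuousAt.2 fun x => ?_
  obtain ⟨C, -, hC⟩ := exists_bound_continuous_sub hk hS (‖x‖ + 1)
  refine continuousAt_of_dominated (bound := fun y => ‖Y y‖ * C)
    (.of_forall fun z => (integrableOn_smul_continuous_sub hk hS hSm hY z).aestronglyMeasurable)
    ?_ (hY.norm.mul_const C)
    (.of_forall fun y => (continuous_const.smul (by fun_prop)).continuousAt)
  filter_upwards [ball_mem_nhds x one_pos] with z hz
  filter_upwards [ae_restrict_mem hSm] with y hy
  rw [norm_smul]
  gcongr
  exact hC z (norm_le_of_mem_ball_one hz) y hy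

/-- Each derivative falls on the kernel, so the induction passes from `F` to `E →L[ℝ] F`. A single
universe for `E` and `F` keeps this target in the range of the induction hypothesis. -/
theorem contDiff_kernelPotential {E F : Type u} [NormedAddCommGroup E] [NormedSpace ℝ E]
    [FiniteDimensional ℝ E] [MeasurableSpace E] [BorelSpace E] [NormedAddCommGroup F]
    [NormedSpace ℝ F] [FiniteDimensional ℝ F] {μ : Measure E} {S : Set E} {Y : E → ℝ} {k : E → F}
    {m : ℕ} (hk : ContDiff ℝ m k)
    (hS : Bornology.IsBounded S) (hSm : MeasurableSet S) (hY : IntegrableOn Y S μ) :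
    ContDiff ℝ m (kernelPotential μ S Y k) := by
  induction m generalizing F with
  | zero => exact contDiff_zero.2 (continuous_kernelPotential (contDiff_zero.1 hk) hS hSm hY)
  | succ m ih =>
    have h1 : ContDiff ℝ 1 k := hk.of_le (by norm_cast; omega)
    rw [Nat.cast_succ, contDiff_succ_iff_hasFDerivAt]
    exact ⟨kernelPotential μ S Y (fderiv ℝ k),
      ih (hk.fderiv_right (by push_cast; exact le_rfl)),
      fun x => hasFDerivAt_kernelPotential h1 hS hSm hY x⟩

variable [μ.IsAddHaarMeasure]

theorem MeasureTheory.LocallyIntegrable.integrableOn_const_sub (hk : LocallyIntegrable k μ)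
    (hS : Bornology.IsBounded S) (hSm : MeasurableSet S) (x : E) :
    IntegrableOn (fun y => k (x - y)) S μ := by
  obtain ⟨R, hR⟩ := exists_norm_sub_le_of_isBounded hS ‖x‖
  have h1 : Integrable ((closedBall (0 : E) R).indicator k) μ :=
    (integrable_indicator_iff measurableSet_closedBall).2
      (hk.integrableOn_isCompact (isCompact_closedBall 0 R))
  refine ((h1.comp_sub_left x).integrableOn (s := S)).congr ?_
  filter_upwards [ae_restrict_mem hSm] with y hy
  exact indicator_of_mem (by simpa using hR x le_rfl y hy) k

theorem integrableOn_smul_const_sub (hk : LocallyIntegrable k μ) (hS : Bornology.IsBounded S)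
    (hSm : MeasurableSet S) (hYm : AEStronglyMeasurable Y (μ.restrict S)) {M : ℝ}
    (hM : ∀ᵐ y ∂μ.restrict S, ‖Y y‖ ≤ M) (x : E) :
    IntegrableOn (fun y => Y y • k (x - y)) S μ :=
  (hk.integrableOn_const_sub hS hSm x).bdd_smul M hYm hM

/-- Translation invariance moves the integral to a fixed ball. The bound depends on x only through
R, which is what makes the convergence of potentials locally uniform. -/
theorem setIntegral_const_sub_le {g : E → ℝ} (hg0 : ∀ z, 0 ≤ g z) (hg : LocallyIntegrable g μ)
    (hSm : MeasurableSet S) {R : ℝ} {x : E} (hR : ∀ y ∈ S, ‖x - y‖ ≤ R) :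
    ∫ y in S, g (x - y) ∂μ ≤ ∫ z in closedBall (0 : E) R, g z ∂μ := by
  have h1 : Integrable ((closedBall (0 : E) R).indicator g) μ :=
    (integrable_indicator_iff measurableSet_closedBall).2
      (hg.integrableOn_isCompact (isCompact_closedBall 0 R))
  rw [← integral_indicator measurableSet_closedBall, ← integral_sub_left_eq_self _ μ x]
  calc ∫ y in S, g (x - y) ∂μ
      = ∫ y in S, (closedBall (0 : E) R).indicator g (x - y) ∂μ :=
        setIntegral_congr_fun hSm fun y hy =>
          (indicator_of_mem (by simpa using hR y hy) g).symm
    _ ≤ ∫ y, (closedBall (0 : E) R).indicator g (x - y) ∂μ :=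
        setIntegral_le_integral (h1.comp_sub_left x)
          (.of_forall fun y => indicator_nonneg (fun z _ => hg0 z) _)

/-- Potentials of a bounded density converge locally uniformly when the kernels converge
almost everywhere and are dominated by a locally integrable function. -/
theorem tendstoLocallyUniformly_kernelPotential {kseq : ℕ → E → F} {A : E → ℝ}
    (hA : LocallyIntegrable A μ) (hmeas : ∀ m, AEStronglyMeasurable (kseq m) μ)
    (hbound : ∀ m, ∀ᵐ z ∂μ, ‖kseq m z‖ ≤ A z)
    (hlim : ∀ᵐ z ∂μ, Tendsto (fun m => kseq m z) atTop (𝓝 (k z)))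
    (hS : Bornology.IsBounded S) (hSm : MeasurableSet S)
    (hYm : AEStronglyMeasurable Y (μ.restrict S)) {M : ℝ} (hM : ∀ᵐ y ∂μ.restrict S, ‖Y y‖ ≤ M) :
    TendstoLocallyUniformly (fun m => kernelPotential μ S Y (kseq m))
      (kernelPotential μ S Y k) atTop := by
  have hkm : AEStronglyMeasurable k μ := aestronglyMeasurable_of_tendsto_ae _ hmeas hlim
  have hkb : ∀ᵐ z ∂μ, ‖k z‖ ≤ A z := by
    filter_upwards [ae_all_iff.2 hbound, hlim] with z h1 h2
    exact le_of_tendsto h2.norm (.of_forall h1)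
  have hk : LocallyIntegrable k μ := hA.mono hkm (hkb.mono fun z hz => hz.trans (le_abs_self _))
  have hki m : LocallyIntegrable (kseq m) μ :=
    hA.mono (hmeas m) ((hbound m).mono fun z hz => hz.trans (le_abs_self _))
  have hd m : LocallyIntegrable (fun z => ‖kseq m z - k z‖) μ :=
    fun x => (((hki m).sub hk) x).norm
  have hM0 : 0 ≤ max M 0 := le_max_right _ _
  -- The L¹ distance of the kernels on a fixed ball, times the bound on Y, will dominate the
  -- difference of the potentials uniformly near each point.
  have key (R : ℝ) : Tendsto (fun m => max M 0 * ∫ z in closedBall (0 : E) R, ‖kseq m z - k z‖ ∂μ)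
      atTop (𝓝 0) := by
    have : Tendsto (fun m => ∫ z in closedBall (0 : E) R, ‖kseq m z - k z‖ ∂μ) atTop
        (𝓝 (∫ z in closedBall (0 : E) R, 0 ∂μ)) := by
      refine tendsto_integral_of_dominated_convergence (fun z => 2 * A z)
        (fun m => ((hd m).aestronglyMeasurable).restrict)
        ((hA.integrableOn_isCompact (isCompact_closedBall 0 R)).const_mul 2) (fun m => ?_) ?_
      · filter_upwards [ae_restrict_of_ae (hbound m), ae_restrict_of_ae hkb] with z h1 h2
        rw [norm_norm]
        linarith [norm_sub_le (kseq m z) (k z)]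
      · filter_upwards [ae_restrict_of_ae hlim] with z h1
        simpa using (h1.sub_const (k z)).norm
    simpa using this.const_mul (max M 0)
  rw [Metric.tendstoLocallyUniformly_iff]
  intro ε hε x
  obtain ⟨R, hR⟩ := exists_norm_sub_le_of_isBounded hS (‖x‖ + 1)
  refine ⟨ball x 1, ball_mem_nhds x one_pos, ?_⟩
  filter_upwards [(key R).eventually (gt_mem_nhds hε)] with m hm z hz
  have hz' : ‖z‖ ≤ ‖x‖ + 1 := norm_le_of_mem_ball_one hz
  refine lt_of_le_of_lt ?_ hm
  rw [dist_comm, dist_eq_norm, kernelPotential, kernelPotential,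
    ← integral_sub (integrableOn_smul_const_sub (hki m) hS hSm hYm hM z)
      (integrableOn_smul_const_sub hk hS hSm hYm hM z)]
  calc ‖∫ y in S, (Y y • kseq m (z - y) - Y y • k (z - y)) ∂μ‖
      ≤ ∫ y in S, max M 0 * ‖kseq m (z - y) - k (z - y)‖ ∂μ := by
        refine norm_integral_le_of_norm_le
          (((hd m).integrableOn_const_sub hS hSm z).const_mul _) ?_
        filter_upwards [hM] with y hy
        rw [← smul_sub, norm_smul]
        gcongr
        exact hy.trans (le_max_left _ _)
    _ = max M 0 * ∫ y in S, ‖kseq m (z - y) - k (z - y)‖ ∂μ := integral_const_mul _ _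
    _ ≤ _ := by
        gcongr
        exact setIntegral_const_sub_le (g := fun z => ‖kseq m z - k z‖)
          (fun z => norm_nonneg _) (hd m) hSm (hR z hz')

/-- A singular kernel that is the dominated limit, together with its derivative, of `C¹` kernels
has `C¹` potentials. -/
theorem contDiff_one_kernelPotential_of_tendsto [FiniteDimensional ℝ F] {kseq : ℕ → E → F}
    {k' : E → E →L[ℝ] F} {A : E → ℝ} (hA : LocallyIntegrable A μ)
    (hsmooth : ∀ m, ContDiff ℝ 1 (kseq m)) (hbound : ∀ m, ∀ᵐ z ∂μ, ‖kseq m z‖ ≤ A z)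
    (hbound' : ∀ m, ∀ᵐ z ∂μ, ‖fderiv ℝ (kseq m) z‖ ≤ A z)
    (hlim : ∀ᵐ z ∂μ, Tendsto (fun m => kseq m z) atTop (𝓝 (k z)))
    (hlim' : ∀ᵐ z ∂μ, Tendsto (fun m => fderiv ℝ (kseq m) z) atTop (𝓝 (k' z)))
    (hS : Bornology.IsBounded S) (hSm : MeasurableSet S)
    (hYm : AEStronglyMeasurable Y (μ.restrict S)) {M : ℝ} (hM : ∀ᵐ y ∂μ.restrict S, ‖Y y‖ ≤ M) :
    ContDiff ℝ 1 (kernelPotential μ S Y k) := by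
  have hc m : Continuous (fderiv ℝ (kseq m)) := (hsmooth m).continuous_fderiv one_ne_zero
  have hY : IntegrableOn Y S μ :=
    haveI : IsFiniteMeasure (μ.restrict S) := ⟨by simpa using hS.measure_lt_top⟩
    Integrable.of_bound hYm M hM
  have h0 := tendstoLocallyUniformly_kernelPotential hA
    (fun m => (hsmooth m).continuous.aestronglyMeasurable) hbound hlim hS hSm hYm hM
  have h1 := tendstoLocallyUniformly_kernelPotential hA
    (fun m => (hc m).aestronglyMeasurable) hbound' hlim' hS hSm hYm hM
  refine contDiff_one_iff_hasFDerivAt.2 ⟨kernelPotential μ S Y k', ?_, fun x => ?_⟩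
  · exact h1.continuous (.of_forall fun m => continuous_kernelPotential (hc m) hS hSm hY)
  · exact hasFDerivAt_of_tendstoLocallyUniformlyOn isOpen_univ
      (tendstoLocallyUniformlyOn_univ.2 h1)
      (fun m x _ => hasFDerivAt_kernelPotential (hsmooth m) hS hSm hY x)
      (fun x _ => (h0.tendstoLocallyUniformlyOn (s := univ)).tendsto_at (mem_univ x)) (mem_univ x)

end KernelPotential

/-! ### The regularized fundamental solution -/

section RegFundSol

variable {n : ℕ}

local notation "𝔼" => EuclideanSpace ℝ (Fin n)

/-- The fundamental solution as a function of the squared norm. -/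
def fundSolProfile (n : ℕ) (s : ℝ) : ℝ :=
  if n = 2 then -(4 * Real.pi)⁻¹ * Real.log s else (4 * Real.pi)⁻¹ * s ^ (-(1 / 2) : ℝ)

/-- The constant in the derivative of `fundSolProfile`. -/
def fundSolConst (n : ℕ) : ℝ := if n = 2 then (4 * Real.pi)⁻¹ else (8 * Real.pi)⁻¹

/-- The fundamental solution, regularized by adding `ε` to the squared norm. -/
def regFundSol (ε : ℝ) (x : EuclideanSpace ℝ (Fin n)) : ℝ := fundSolProfile n (‖x‖ ^ 2 + ε)

/-- The derivative of `regFundSol`. -/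
def regFundSolDeriv (ε : ℝ) (x : EuclideanSpace ℝ (Fin n)) : EuclideanSpace ℝ (Fin n) →L[ℝ] ℝ :=
  (-2 * fundSolConst n * (‖x‖ ^ 2 + ε) ^ (-(n / 2) : ℝ)) • innerSL ℝ x

theorem fundSolConst_nonneg (n : ℕ) : 0 ≤ fundSolConst n := by
  unfold fundSolConst; split_ifs <;> positivity

theorem fundSolConst_le (n : ℕ) : 2 * fundSolConst n ≤ 1 := by
  have := Real.pi_gt_three
  unfold fundSolConst; split_ifs
  · rw [← le_div_iff₀' two_pos, inv_le_comm₀ (by positivity) (by norm_num)]; linarith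
  · rw [← le_div_iff₀' two_pos, inv_le_comm₀ (by positivity) (by norm_num)]; linarith

theorem regFundSol_zero (hn : n = 2 ∨ n = 3) : regFundSol (n := n) 0 = fundSol := by
  ext x
  rcases hn with rfl | rfl
  · simp only [regFundSol, fundSolProfile, fundSol, add_zero, if_true, Real.log_pow]
    push_cast
    field
  · have h : (‖x‖ ^ 2) ^ (-(1 / 2) : ℝ) = ‖x‖⁻¹ := by
      rw [← Real.rpow_natCast, ← Real.rpow_mul (norm_nonneg x), ← Real.rpow_neg_one]
      norm_num
    simp [regFundSol, fundSolProfile, fundSol, h, -one_div, mul_comm]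

theorem hasDerivAt_fundSolProfile (hn : n = 2 ∨ n = 3) {s : ℝ} (hs : 0 < s) :
    HasDerivAt (fundSolProfile n) (-fundSolConst n * s ^ (-(n / 2) : ℝ)) s := by
  rcases hn with rfl | rfl
  · have : fundSolProfile 2 = fun s => -(4 * Real.pi)⁻¹ * Real.log s := by
      ext; simp [fundSolProfile]
    rw [this]
    convert! (Real.hasDerivAt_log hs.ne').const_mul (-(4 * Real.pi)⁻¹) using 1
    simp [fundSolConst, Real.rpow_neg_one]
  · have : fundSolProfile 3 = fun s => (4 * Real.pi)⁻¹ * s ^ (-(1 / 2) : ℝ) := by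
      ext; simp [fundSolProfile]
    rw [this]
    convert! (Real.hasDerivAt_rpow_const (p := -(1 / 2)) (Or.inl hs.ne')).const_mul
      (4 * Real.pi)⁻¹ using 1
    norm_num [fundSolConst]
    ring

theorem contDiffAt_fundSolProfile {s : ℝ} (hs : 0 < s) :
    ContDiffAt ℝ ∞ (fundSolProfile n) s := by
  unfold fundSolProfile
  split_ifs
  · exact contDiffAt_const.mul (Real.contDiffAt_log.2 hs.ne')
  · exact contDiffAt_const.mul (Real.contDiffAt_rpow_const_of_ne hs.ne')

theorem contDiffAt_regFundSol {ε : ℝ} {x : 𝔼} (hx : 0 < ‖x‖ ^ 2 + ε) :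
    ContDiffAt ℝ ∞ (regFundSol (n := n) ε) x :=
  (contDiffAt_fundSolProfile hx).comp x ((contDiff_norm_sq ℝ).contDiffAt.add contDiffAt_const)

theorem hasFDerivAt_norm_sq_add (ε : ℝ) (x : 𝔼) :
    HasFDerivAt (fun y : 𝔼 => ‖y‖ ^ 2 + ε) ((2 : ℝ) • innerSL ℝ x) x := by
  have := ((hasStrictFDerivAt_norm_sq x).hasFDerivAt).add_const ε
  refine this.congr_fderiv ?_
  ext; simp [two_mul]

theorem hasFDerivAt_regFundSol (hn : n = 2 ∨ n = 3) {ε : ℝ} {x : 𝔼} (hx : 0 < ‖x‖ ^ 2 + ε) :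
    HasFDerivAt (regFundSol (n := n) ε) (regFundSolDeriv ε x) x := by
  have h := (hasDerivAt_fundSolProfile hn hx).comp_hasFDerivAt x (hasFDerivAt_norm_sq_add ε x)
  refine h.congr_fderiv ?_
  rw [regFundSolDeriv, smul_smul]
  congr 1; ring

theorem eventually_pos_norm_sq_add {ε : ℝ} {x : 𝔼} (hx : 0 < ‖x‖ ^ 2 + ε) :
    ∀ᶠ y : 𝔼 in 𝓝 x, 0 < ‖y‖ ^ 2 + ε :=
  (by fun_prop : Continuous fun y : 𝔼 => ‖y‖ ^ 2 + ε).continuousAt.eventually (lt_mem_nhds hx)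

/-- With s = ‖x‖² + ε the gradient is -2c s^(-n/2) x. Its divergence is -2cn s^(-n/2-1) (s - ‖x‖²),
and the last factor is ε. The case ε = 0, x ≠ 0 is the harmonicity of Γ. -/
theorem laplacian_regFundSol (hn : n = 2 ∨ n = 3) {ε : ℝ} {x : 𝔼} (hx : 0 < ‖x‖ ^ 2 + ε) :
    Δ (regFundSol (n := n) ε) x =
      -(2 * n * fundSolConst n * ε * (‖x‖ ^ 2 + ε) ^ (-(n / 2) - 1 : ℝ)) := by
  have h1 : fderiv ℝ (regFundSol (n := n) ε) =ᶠ[𝓝 x] regFundSolDeriv ε := by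
    filter_upwards [eventually_pos_norm_sq_add hx] with y hy
    exact (hasFDerivAt_regFundSol hn hy).fderiv
  set s := ‖x‖ ^ 2 + ε with hs
  have h2 : HasFDerivAt (fun y : 𝔼 => -2 * fundSolConst n * (‖y‖ ^ 2 + ε) ^ (-(n / 2) : ℝ))
      ((-2 * fundSolConst n * (-(n / 2) * s ^ (-(n / 2) - 1 : ℝ))) • (2 : ℝ) • innerSL ℝ x) x :=
    ((Real.hasDerivAt_rpow_const (p := -(n / 2)) (Or.inl hx.ne')).const_mul
      (-2 * fundSolConst n)).comp_hasFDerivAt (f := fun y : 𝔼 => ‖y‖ ^ 2 + ε) x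
      (hasFDerivAt_norm_sq_add ε x)
  have h3 := h2.smul (innerSL ℝ : 𝔼 →L[ℝ] 𝔼 →L[ℝ] ℝ).hasFDerivAt
  rw [InnerProductSpace.laplacian_eq_iteratedFDeriv_orthonormalBasis _
    (EuclideanSpace.basisFun (Fin n) ℝ)]
  have h4 (i : Fin n) : iteratedFDeriv ℝ 2 (regFundSol (n := n) ε) x
      ![EuclideanSpace.basisFun (Fin n) ℝ i, EuclideanSpace.basisFun (Fin n) ℝ i] =
      -2 * fundSolConst n * s ^ (-(n / 2) : ℝ) +
        2 * n * fundSolConst n * s ^ (-(n / 2) - 1 : ℝ) * x i ^ 2 := by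
    rw [iteratedFDeriv_two_apply, h1.fderiv_eq]
    have h5 : fderiv ℝ (regFundSolDeriv ε) x = _ := h3.fderiv
    have h6 (y z : 𝔼) : (innerSL ℝ : 𝔼 →L[ℝ] 𝔼 →L[ℝ] ℝ) y z = inner ℝ y z := rfl
    rw [h5]
    simp [h6, EuclideanSpace.inner_single_right, ← hs]
    ring
  simp only [h4, Finset.sum_add_distrib, ← Finset.mul_sum, Finset.sum_const, Finset.card_univ,
    Fintype.card_fin, nsmul_eq_mul]
  have h7 : ∑ i, x.ofLp i ^ 2 = s - ε := by simp [hs, EuclideanSpace.real_norm_sq_eq]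
  have h8 : s ^ (-(n / 2) : ℝ) = s ^ (-(n / 2) - 1 : ℝ) * s := by
    rw [Real.rpow_sub_one hx.ne', div_mul_cancel₀ _ hx.ne']
  rw [h7, h8]
  ring

theorem harmonicAt_fundSol (hn : n = 2 ∨ n = 3) {x : 𝔼} (hx : x ≠ 0) :
    InnerProductSpace.HarmonicAt (fundSol (n := n)) x := by
  have hx' : 0 < ‖x‖ ^ 2 + 0 := by positivity
  rw [← regFundSol_zero hn]
  refine ⟨(contDiffAt_regFundSol hx').of_le (by norm_cast), ?_⟩
  filter_upwards [eventually_pos_norm_sq_add hx'] with y hy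
  rw [laplacian_regFundSol hn hy]
  simp

/-- A locally integrable function that dominates the regularized fundamental solutions and
their derivatives. -/
def fundSolMajorant (x : EuclideanSpace ℝ (Fin n)) : ℝ := 1 + ‖x‖ ^ 2 + ‖x‖ ^ (-(n - 1) : ℝ)

theorem locallyIntegrable_fundSolMajorant (hn : n = 2 ∨ n = 3) :
    LocallyIntegrable (fundSolMajorant (n := n)) := by
  refine LocallyIntegrable.add (f := fun x : 𝔼 => 1 + ‖x‖ ^ 2)
    (by fun_prop : Continuous fun x : 𝔼 => 1 + ‖x‖ ^ 2).locallyIntegrable ?_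
  refine locallyIntegrable_of_norm_le_rpow (C := 1) (α := n - 1) ?_ (by simp) (.of_forall fun x => ?_)
    ((measurable_norm.pow_const _).aestronglyMeasurable)
  · simp; omega
  · rw [one_mul, Real.norm_of_nonneg (by positivity)]

/-- For n = 2, log s ≤ s - 1 bounds the logarithm from above, and -log(r² + ε) ≤ 2 log(1/r) ≤ 2/r
bounds it from below. For n = 3 the kernel is at most 1/r, and 1/r ≤ 1 + 1/r². -/
theorem norm_regFundSol_le (hn : n = 2 ∨ n = 3) {ε : ℝ} (h0 : 0 ≤ ε) (h1 : ε ≤ 1) {x : 𝔼}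
    (hx : x ≠ 0) : ‖regFundSol ε x‖ ≤ fundSolMajorant x := by
  have hr : 0 < ‖x‖ := norm_pos_iff.2 hx
  have hpi := Real.pi_gt_three
  set r := ‖x‖ with hrdef
  rcases hn with rfl | rfl
  · have e : fundSolMajorant x = 1 + r ^ 2 + r⁻¹ := by
      simp only [fundSolMajorant, ← hrdef]; norm_num [Real.rpow_neg_one]
    rw [e]
    have a1 : Real.log (r ^ 2 + ε) ≤ r ^ 2 + 1 :=
      (Real.log_le_sub_one_of_pos (by positivity)).trans (by linarith)
    have a2 : -Real.log (r ^ 2 + ε) ≤ 2 * r⁻¹ := by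
      have b1 : Real.log (r ^ 2) ≤ Real.log (r ^ 2 + ε) :=
        Real.log_le_log (by positivity) (by linarith)
      have b2 := Real.log_le_sub_one_of_pos (inv_pos.2 hr)
      rw [Real.log_inv] at b2
      rw [Real.log_pow] at b1
      push_cast at b1
      linarith
    have a3 : |Real.log (r ^ 2 + ε)| ≤ 2 * (1 + r ^ 2 + r⁻¹) := by
      have : 0 < r⁻¹ := inv_pos.2 hr
      rw [abs_le]; constructor <;> nlinarith
    have a4 : (4 * Real.pi)⁻¹ ≤ 1 / 2 := by
      rw [inv_le_comm₀ (by positivity) (by norm_num)]; norm_num; linarith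
    simp only [regFundSol, fundSolProfile, if_true, norm_mul, norm_neg, Real.norm_eq_abs]
    rw [abs_of_nonneg (by positivity : 0 ≤ (4 * Real.pi)⁻¹)]
    calc (4 * Real.pi)⁻¹ * |Real.log (r ^ 2 + ε)| ≤ 1 / 2 * (2 * (1 + r ^ 2 + r⁻¹)) := by gcongr
      _ = _ := by ring
  · have e : fundSolMajorant x = 1 + r ^ 2 + (r ^ 2)⁻¹ := by
      simp only [fundSolMajorant, ← hrdef]
      rw [show (-((3 : ℕ) - 1) : ℝ) = -(2 : ℕ) by norm_num, Real.rpow_neg hr.le, Real.rpow_natCast]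
    rw [e]
    have a1 : (r ^ 2 + ε) ^ (-(1 / 2) : ℝ) ≤ r⁻¹ := by
      calc (r ^ 2 + ε) ^ (-(1 / 2) : ℝ) ≤ (r ^ 2) ^ (-(1 / 2) : ℝ) :=
            Real.rpow_le_rpow_of_nonpos (by positivity) (by linarith) (by norm_num)
        _ = r⁻¹ := by
            rw [← Real.rpow_natCast, ← Real.rpow_mul hr.le, ← Real.rpow_neg_one]; norm_num
    have a4 : (4 * Real.pi)⁻¹ ≤ 1 := by
      rw [inv_le_comm₀ (by positivity) (by norm_num)]; linarith
    have a5 : r⁻¹ ≤ 1 + (r ^ 2)⁻¹ := by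
      rw [← inv_pow]; nlinarith [sq_nonneg (r⁻¹ - 1), inv_pos.2 hr]
    have a6 : 0 ≤ (r ^ 2 + ε) ^ (-(1 / 2) : ℝ) := by positivity
    have e2 : regFundSol ε x = (4 * Real.pi)⁻¹ * (r ^ 2 + ε) ^ (-(1 / 2) : ℝ) := by
      simp [regFundSol, fundSolProfile, ← hrdef]
    rw [e2, Real.norm_of_nonneg (by positivity)]
    calc _ ≤ 1 * (r ^ 2 + ε) ^ (-(1 / 2) : ℝ) := by gcongr
      _ ≤ _ := by nlinarith [sq_nonneg r]

theorem norm_regFundSolDeriv_le {ε : ℝ} (h0 : 0 ≤ ε) {x : 𝔼}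
    (hx : x ≠ 0) : ‖regFundSolDeriv ε x‖ ≤ fundSolMajorant x := by
  have hr : 0 < ‖x‖ := norm_pos_iff.2 hx
  have hc := fundSolConst_nonneg n
  rw [regFundSolDeriv, norm_smul, innerSL_apply_norm, norm_mul, norm_mul, norm_neg,
    Real.norm_of_nonneg hc, Real.norm_of_nonneg (by norm_num : (0 : ℝ) ≤ 2),
    Real.norm_of_nonneg (by positivity)]
  calc 2 * fundSolConst n * (‖x‖ ^ 2 + ε) ^ (-(n / 2) : ℝ) * ‖x‖
      ≤ 1 * (‖x‖ ^ 2) ^ (-(n / 2) : ℝ) * ‖x‖ := by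
        gcongr ?_ * ?_ * _
        · exact fundSolConst_le n
        · refine Real.rpow_le_rpow_of_nonpos (by positivity) (by linarith) ?_
          have : (0 : ℝ) ≤ n / 2 := by positivity
          linarith
    _ = ‖x‖ ^ (-(n - 1) : ℝ) := by
        rw [one_mul, ← Real.rpow_natCast, ← Real.rpow_mul hr.le,
          show (-(n - 1) : ℝ) = ((2 : ℕ) : ℝ) * -(n / 2) + 1 by push_cast; ring,
          Real.rpow_add_one hr.ne']
    _ ≤ _ := by unfold fundSolMajorant; linarith [sq_nonneg ‖x‖]

theorem tendsto_regFundSol {u : ℕ → ℝ} (hu : Tendsto u atTop (𝓝 0)) {x : 𝔼} (hx : x ≠ 0) :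
    Tendsto (fun m => regFundSol (u m) x) atTop (𝓝 (regFundSol 0 x)) := by
  have hx' : 0 < ‖x‖ ^ 2 + 0 := by positivity
  exact (contDiffAt_fundSolProfile hx').continuousAt.tendsto.comp (hu.const_add _)

theorem tendsto_regFundSolDeriv {u : ℕ → ℝ} (hu : Tendsto u atTop (𝓝 0)) {x : 𝔼} (hx : x ≠ 0) :
    Tendsto (fun m => regFundSolDeriv (u m) x) atTop (𝓝 (regFundSolDeriv 0 x)) := by
  have hx' : ‖x‖ ^ 2 + 0 ≠ 0 := by positivity
  exact (((Real.continuousAt_rpow_const _ _ (Or.inl hx')).tendsto.comp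
    (hu.const_add _)).const_mul _).smul_const _

theorem nontrivial_of_dim (hn : n = 2 ∨ n = 3) : Nontrivial 𝔼 := by
  refine Module.nontrivial_of_finrank_pos (R := ℝ) ?_
  simp; omega

theorem ae_ne_zero (hn : n = 2 ∨ n = 3) : ∀ᵐ x : 𝔼, x ≠ 0 := by
  have := nontrivial_of_dim hn
  exact Measure.ae_ne volume 0

end RegFundSol

/-! ### Green's second identity on the whole space -/

section Green

theorem laplacian_eq_sum_fderiv {E ι : Type*} [NormedAddCommGroup E] [InnerProductSpace ℝ E]
    [FiniteDimensional ℝ E] [Fintype ι] (b : OrthonormalBasis ι ℝ E) {f : E → ℝ}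
    (hf : ContDiff ℝ 2 f) (x : E) :
    Δ f x = ∑ i, fderiv ℝ (fun y => fderiv ℝ f y (b i)) x (b i) := by
  have hd : DifferentiableAt ℝ (fderiv ℝ f) x :=
    (hf.fderiv_right (m := 1) (by norm_num)).differentiable one_ne_zero x
  rw [InnerProductSpace.laplacian_eq_iteratedFDeriv_orthonormalBasis f b]
  refine Finset.sum_congr rfl fun i _ => ?_
  rw [iteratedFDeriv_two_apply, fderiv_clm_apply hd (differentiableAt_const _)]
  simp

theorem ContDiff.continuous_laplacian {E : Type*} [NormedAddCommGroup E] [InnerProductSpace ℝ E]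
    [FiniteDimensional ℝ E] {f : E → ℝ} (hf : ContDiff ℝ 2 f) : Continuous (Δ f) := by
  rw [funext (laplacian_eq_sum_fderiv (stdOrthonormalBasis ℝ E) hf)]
  refine continuous_finsetSum _ fun i _ => ?_
  have h1 : ContDiff ℝ 1 fun y => fderiv ℝ f y (stdOrthonormalBasis ℝ E i) :=
    (hf.fderiv_right (m := 1) (by norm_num)).clm_apply contDiff_const
  exact (h1.continuous_fderiv one_ne_zero).clm_apply continuous_const

theorem laplacian_eq_zero_of_notMem_tsupport {E : Type*} [NormedAddCommGroup E]
    [InnerProductSpace ℝ E] [FiniteDimensional ℝ E] {f : E → ℝ} {x : E} (hx : x ∉ tsupport f) :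
    Δ f x = 0 := by
  have h : f =ᶠ[𝓝 x] fun _ => 0 := notMem_tsupport_iff_eventuallyEq.1 hx
  rw [InnerProductSpace.laplacian_congr_nhds h |>.eq_of_nhds]
  simp

theorem HasCompactSupport.laplacian {E : Type*} [NormedAddCommGroup E]
    [InnerProductSpace ℝ E] [FiniteDimensional ℝ E] {f : E → ℝ} (hf : HasCompactSupport f) :
    HasCompactSupport (Δ f) :=
  HasCompactSupport.intro hf fun _ hx => laplacian_eq_zero_of_notMem_tsupport hx

/-- Green's second identity for a compactly supported factor. -/
theorem integral_mul_laplacian_eq {E : Type*} [NormedAddCommGroup E] [InnerProductSpace ℝ E]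
    [FiniteDimensional ℝ E] [MeasurableSpace E] [BorelSpace E] {μ : Measure E}
    [μ.IsAddHaarMeasure] {u φ : E → ℝ} (hu : ContDiff ℝ 2 u)
    (hφ : ContDiff ℝ 2 φ) (hφc : HasCompactSupport φ) :
    ∫ x, u x * Δ φ x ∂μ = ∫ x, Δ u x * φ x ∂μ := by
  set b := stdOrthonormalBasis ℝ E
  have du (v : E) : ContDiff ℝ 1 fun y => fderiv ℝ u y v :=
    (hu.fderiv_right (m := 1) (by norm_num)).clm_apply contDiff_const
  have dφ (v : E) : ContDiff ℝ 1 fun y => fderiv ℝ φ y v :=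
    (hφ.fderiv_right (m := 1) (by norm_num)).clm_apply contDiff_const
  have ddu (v : E) : Continuous fun x => fderiv ℝ (fun y => fderiv ℝ u y v) x v :=
    ((du v).continuous_fderiv one_ne_zero).clm_apply continuous_const
  have ddφ (v : E) : Continuous fun x => fderiv ℝ (fun y => fderiv ℝ φ y v) x v :=
    ((dφ v).continuous_fderiv one_ne_zero).clm_apply continuous_const
  have cφ (v : E) : HasCompactSupport fun y => fderiv ℝ φ y v := hφc.fderiv_apply ℝ v
  have ccφ (v : E) : HasCompactSupport fun x => fderiv ℝ (fun y => fderiv ℝ φ y v) x v :=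
    (cφ v).fderiv_apply ℝ v
  have int {f g : E → ℝ} (hf : Continuous f) (hg : Continuous g) (hc : HasCompactSupport g) :
      Integrable (fun x => f x * g x) μ :=
    (hf.mul hg).integrable_of_hasCompactSupport hc.mul_left
  -- Two integrations by parts in the direction v; the compact support of φ supplies the
  -- integrability they need.
  have key (v : E) : ∫ x, u x * fderiv ℝ (fun y => fderiv ℝ φ y v) x v ∂μ =
      ∫ x, fderiv ℝ (fun y => fderiv ℝ u y v) x v * φ x ∂μ := by
    rw [integral_mul_fderiv_eq_neg_fderiv_mul_of_integrable (int (du v).continuous (dφ v).continuous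
        (cφ v)) (int hu.continuous (ddφ v) (ccφ v)) (int hu.continuous (dφ v).continuous (cφ v))
        (fun x _ => hu.differentiable two_ne_zero x)
        (fun x _ => (dφ v).differentiable one_ne_zero x),
      integral_mul_fderiv_eq_neg_fderiv_mul_of_integrable (int (ddu v) hφ.continuous hφc)
        (int (du v).continuous (dφ v).continuous (cφ v)) (int (du v).continuous hφ.continuous hφc)
        (fun x _ => (du v).differentiable one_ne_zero x)
        (fun x _ => hφ.differentiable two_ne_zero x), neg_neg]
  simp only [laplacian_eq_sum_fderiv b hu, laplacian_eq_sum_fderiv b hφ, Finset.mul_sum,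
    Finset.sum_mul]
  rw [integral_finsetSum _ fun i _ => int hu.continuous (ddφ _) (ccφ _),
    integral_finsetSum _ fun i _ => int (ddu _) hφ.continuous hφc]
  exact Finset.sum_congr rfl fun i _ => key (b i)

end Green

/-! ### The distributional identity -ΔΓ = δ₀ -/

section FundSol

variable {n : ℕ}

local notation "𝔼" => EuclideanSpace ℝ (Fin n)

/-- Minus the Laplacian of `regFundSol 1`. -/
def fundSolPeak (x : EuclideanSpace ℝ (Fin n)) : ℝ :=
  2 * n * fundSolConst n * (‖x‖ ^ 2 + 1) ^ (-(n / 2) - 1 : ℝ)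

theorem fundSolPeak_nonneg (x : 𝔼) : 0 ≤ fundSolPeak x := by
  have := fundSolConst_nonneg n
  unfold fundSolPeak; positivity

/-- The normalization of Γ: this is the constant left in front of the radial integral of
`fundSolPeak` in polar coordinates. -/
theorem two_mul_fundSolConst_mul_volume_ball (hn : n = 2 ∨ n = 3) :
    2 * n * fundSolConst n * (volume : Measure 𝔼).real (ball 0 1) = 1 := by
  have := Real.pi_pos
  rcases hn with rfl | rfl
  · rw [Measure.real, EuclideanSpace.volume_ball_fin_two]
    simp [fundSolConst]
    rw [ENNReal.toReal_ofReal (by positivity)]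
    field
  · rw [Measure.real, EuclideanSpace.volume_ball_fin_three]
    simp [fundSolConst]
    rw [ENNReal.toReal_ofReal (by positivity)]
    field

/-- The integrand has the explicit primitive yⁿ (y² + 1)^(-n/2), which vanishes at 0 and tends to 1
at infinity. -/
theorem integral_Ioi_pow_mul_rpow (hn : n ≠ 0) :
    ∫ y in Ioi (0 : ℝ), n * (y ^ (n - 1) * (y ^ 2 + 1) ^ (-(n / 2) - 1 : ℝ)) = 1 := by
  have hpos (y : ℝ) : 0 < y ^ 2 + 1 := by positivity
  have hd (y : ℝ) : HasDerivAt (fun y : ℝ => y ^ n * (y ^ 2 + 1) ^ (-(n / 2) : ℝ))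
      (n * (y ^ (n - 1) * (y ^ 2 + 1) ^ (-(n / 2) - 1 : ℝ))) y := by
    have h1 := (hasDerivAt_pow n y).mul
      (((hasDerivAt_pow 2 y).add_const 1).rpow_const (p := -(n / 2)) (Or.inl (hpos y).ne'))
    convert! h1 using 1
    obtain ⟨m, rfl⟩ := Nat.exists_eq_succ_of_ne_zero hn
    have h2 : (y ^ 2 + 1) ^ (-((m.succ : ℕ) / 2) : ℝ) =
        (y ^ 2 + 1) ^ (-((m.succ : ℕ) / 2) - 1 : ℝ) * (y ^ 2 + 1) := by
      rw [Real.rpow_sub_one (hpos y).ne', div_mul_cancel₀ _ (hpos y).ne']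
    rw [h2]
    simp only [Nat.succ_eq_add_one, Nat.add_sub_cancel, pow_succ]
    push_cast
    ring
  have hlim : Tendsto (fun y : ℝ => y ^ n * (y ^ 2 + 1) ^ (-(n / 2) : ℝ)) atTop (𝓝 1) := by
    have h1 : Tendsto (fun y : ℝ => (1 + (y ^ 2)⁻¹) ^ (-(n / 2) : ℝ)) atTop (𝓝 1) := by
      have h2 : Tendsto (fun y : ℝ => 1 + (y ^ 2)⁻¹) atTop (𝓝 1) := by
        simpa using (tendsto_inv_atTop_zero.comp (tendsto_pow_atTop two_ne_zero)).const_add (1 : ℝ)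
      simpa using h2.rpow_const (p := -(n / 2)) (Or.inl one_ne_zero)
    refine h1.congr' ?_
    filter_upwards [eventually_gt_atTop 0] with y hy
    have h3 : y ^ 2 + 1 = y ^ 2 * (1 + (y ^ 2)⁻¹) := by field_simp
    rw [h3, Real.mul_rpow (by positivity) (by positivity), ← Real.rpow_natCast y 2,
      ← Real.rpow_mul hy.le, ← mul_assoc, ← Real.rpow_natCast y n, ← Real.rpow_add hy]
    have h4 : (n : ℝ) + ((2 : ℕ) : ℝ) * -(n / 2) = 0 := by push_cast; ring
    rw [h4, Real.rpow_zero, one_mul]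
  rw [integral_Ioi_of_hasDerivAt_of_nonneg' (fun y _ => hd y)
    (fun y (hy : 0 < y) => by positivity) hlim]
  simp [hn]

theorem integral_fundSolPeak (hn : n = 2 ∨ n = 3) : ∫ x : 𝔼, fundSolPeak x = 1 := by
  have hn0 : n ≠ 0 := by omega
  have := nontrivial_of_dim hn
  unfold fundSolPeak
  rw [integral_fun_norm_addHaar volume
    fun r : ℝ => 2 * n * fundSolConst n * (r ^ 2 + 1) ^ (-(n / 2) - 1 : ℝ)]
  have h1 := integral_Ioi_pow_mul_rpow hn0
  have h2 := two_mul_fundSolConst_mul_volume_ball hn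
  simp only [finrank_euclideanSpace, Fintype.card_fin, smul_eq_mul, nsmul_eq_mul]
  simp_rw [mul_left_comm _ (2 * (n : ℝ) * fundSolConst n)]
  rw [integral_const_mul] at h1 ⊢
  calc _ = (2 * n * fundSolConst n * (volume : Measure 𝔼).real (ball 0 1)) *
      (n * ∫ y in Ioi (0 : ℝ), y ^ (n - 1) * (y ^ 2 + 1) ^ (-(n / 2) - 1 : ℝ)) := by ring
    _ = 1 := by rw [h1, h2, one_mul]

/-- The decay at infinity required of the profile of an approximate identity; the product is
O(‖x‖⁻²). -/
theorem tendsto_norm_pow_mul_fundSolPeak :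
    Tendsto (fun x : 𝔼 => ‖x‖ ^ n * fundSolPeak x) (Bornology.cobounded 𝔼) (𝓝 0) := by
  have hc := fundSolConst_nonneg n
  have h1 : Tendsto (fun x : 𝔼 => 2 * n * fundSolConst n * (‖x‖ ^ 2)⁻¹)
      (Bornology.cobounded 𝔼) (𝓝 0) := by
    have := ((tendsto_inv_atTop_zero.comp (tendsto_pow_atTop two_ne_zero)).comp
      (tendsto_norm_cobounded_atTop (E := 𝔼))).const_mul (2 * n * fundSolConst n)
    simpa using this
  refine squeeze_zero' (.of_forall fun x => mul_nonneg (by positivity) (fundSolPeak_nonneg x)) ?_ h1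
  filter_upwards [eventually_cobounded_le_norm 1] with x hx
  have hr : 0 < ‖x‖ := by linarith
  have h2 : ‖x‖ ^ n * (‖x‖ ^ 2 + 1) ^ (-(n / 2) - 1 : ℝ) ≤ (‖x‖ ^ 2)⁻¹ := by
    calc ‖x‖ ^ n * (‖x‖ ^ 2 + 1) ^ (-(n / 2) - 1 : ℝ)
        ≤ ‖x‖ ^ n * (‖x‖ ^ 2) ^ (-(n / 2) - 1 : ℝ) := by
          gcongr _ * ?_
          refine Real.rpow_le_rpow_of_nonpos (by positivity) (by linarith) ?_
          have : (0 : ℝ) ≤ n / 2 := by positivity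
          linarith
      _ = (‖x‖ ^ 2)⁻¹ := by
          rw [← Real.rpow_natCast, ← Real.rpow_natCast, ← Real.rpow_mul hr.le, ← Real.rpow_add hr,
            ← Real.rpow_neg hr.le]
          congr 1; push_cast; ring
  calc ‖x‖ ^ n * fundSolPeak x
      = 2 * n * fundSolConst n * (‖x‖ ^ n * (‖x‖ ^ 2 + 1) ^ (-(n / 2) - 1 : ℝ)) := by
        unfold fundSolPeak; ring
    _ ≤ _ := by gcongr

/-- Scaling: with ε = c⁻² the negative Laplacians are the mass-preserving dilates of one profile, so
they concentrate at 0 as c → ∞. -/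
theorem laplacian_regFundSol_eq_peak (hn : n = 2 ∨ n = 3) {c : ℝ} (hc : 0 < c) (x : 𝔼) :
    Δ (regFundSol (n := n) (c ^ 2)⁻¹) x = -(c ^ n * fundSolPeak (c • x)) := by
  rw [laplacian_regFundSol hn (by positivity), fundSolPeak, norm_smul, Real.norm_of_nonneg hc.le]
  have h1 : (c * ‖x‖) ^ 2 + 1 = c ^ 2 * (‖x‖ ^ 2 + (c ^ 2)⁻¹) := by field_simp
  have h2 : c ^ n * (c ^ 2) ^ (-(n / 2) - 1 : ℝ) = (c ^ 2)⁻¹ := by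
    rw [← Real.rpow_natCast, ← Real.rpow_natCast, ← Real.rpow_mul hc.le, ← Real.rpow_add hc,
      ← Real.rpow_neg hc.le]
    congr 1; push_cast; ring
  rw [h1, Real.mul_rpow (by positivity) (by positivity), ← h2]
  ring

/-- The regularization parameters `1/(m+1)²`. -/
def regParam (m : ℕ) : ℝ := (((m : ℝ) + 1) ^ 2)⁻¹

theorem regParam_pos (m : ℕ) : 0 < regParam m := by unfold regParam; positivity

theorem regParam_le_one (m : ℕ) : regParam m ≤ 1 := by
  unfold regParam
  refine inv_le_one_of_one_le₀ (one_le_pow₀ ?_)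
  linarith [(Nat.cast_nonneg m : (0 : ℝ) ≤ m)]

theorem tendsto_regParam : Tendsto regParam atTop (𝓝 0) :=
  (tendsto_inv_atTop_zero.comp (tendsto_pow_atTop two_ne_zero)).comp
    (tendsto_atTop_add_const_right _ _ tendsto_natCast_atTop_atTop)

theorem contDiff_regFundSol {ε : ℝ} (hε : 0 < ε) : ContDiff ℝ ∞ (regFundSol (n := n) ε) :=
  contDiff_iff_contDiffAt.2 fun _ => contDiffAt_regFundSol (by positivity)

theorem locallyIntegrable_fundSol (hn : n = 2 ∨ n = 3) :
    LocallyIntegrable (fundSol (n := n)) := by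
  have hlim : ∀ᵐ x : 𝔼, Tendsto (fun m => regFundSol (regParam m) x) atTop (𝓝 (fundSol x)) := by
    filter_upwards [ae_ne_zero hn] with x hx
    exact regFundSol_zero hn ▸ tendsto_regFundSol tendsto_regParam hx
  refine (locallyIntegrable_fundSolMajorant hn).mono
    (aestronglyMeasurable_of_tendsto_ae _ (fun m =>
      (contDiff_regFundSol (regParam_pos m)).continuous.aestronglyMeasurable) hlim) ?_
  filter_upwards [ae_ne_zero hn] with x hx
  rw [← regFundSol_zero hn]
  exact (norm_regFundSol_le hn le_rfl zero_le_one hx).trans (le_abs_self _)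

/-- The identity `-Δ Γ = δ₀` in the sense of distributions. -/
theorem integral_fundSol_mul_laplacian (hn : n = 2 ∨ n = 3) {φ : 𝔼 → ℝ} (hφ : ContDiff ℝ 2 φ)
    (hφc : HasCompactSupport φ) : ∫ x, fundSol x * Δ φ x = -φ 0 := by
  have hΔ := hφ.continuous_laplacian
  have h1 : Tendsto (fun m => ∫ x : 𝔼, regFundSol (regParam m) x * Δ φ x) atTop
      (𝓝 (∫ x : 𝔼, fundSol x * Δ φ x)) := by
    refine tendsto_integral_of_dominated_convergence (fun x => ‖fundSolMajorant x • Δ φ x‖)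
      (fun m => ((contDiff_regFundSol (regParam_pos m)).continuous.mul hΔ).aestronglyMeasurable)
      ?_ (fun m => ?_) ?_
    · exact ((locallyIntegrable_fundSolMajorant hn).integrable_smul_right_of_hasCompactSupport hΔ
        hφc.laplacian).norm
    · filter_upwards [ae_ne_zero hn] with x hx
      rw [norm_mul, norm_smul]
      gcongr
      exact (norm_regFundSol_le hn (regParam_pos m).le (regParam_le_one m) hx).trans
        (le_abs_self _)
    · filter_upwards [ae_ne_zero hn] with x hx
      exact (regFundSol_zero hn ▸ tendsto_regFundSol tendsto_regParam hx).mul_const _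
  -- Green's identity moves the Laplacian onto the kernel, where it is minus the approximate
  -- identity with dilation factor m + 1.
  have h2 : Tendsto (fun m => ∫ x : 𝔼, regFundSol (regParam m) x * Δ φ x) atTop (𝓝 (-φ 0)) := by
    have h3 := (tendsto_integral_comp_smul_smul_of_integrable (μ := (volume : Measure 𝔼))
      fundSolPeak_nonneg (integral_fundSolPeak hn)
      (by simpa using tendsto_norm_pow_mul_fundSolPeak (n := n))
      (hφ.continuous.integrable_of_hasCompactSupport hφc) hφ.continuous.continuousAt).neg.comp
      (tendsto_atTop_add_const_right _ (1 : ℝ) tendsto_natCast_atTop_atTop)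
    refine h3.congr fun m => ?_
    rw [integral_mul_laplacian_eq ((contDiff_regFundSol (regParam_pos m)).of_le (by norm_cast))
      hφ hφc, Function.comp_apply, ← integral_neg]
    congr 1 with x
    rw [regParam, laplacian_regFundSol_eq_peak hn (by positivity)]
    simp
  exact tendsto_nhds_unique h1 h2

end FundSol

/-! ### Regularity of the Newtonian potential and the Poisson equation -/

section NewtonPotential

variable {n : ℕ}

local notation "𝔼" => EuclideanSpace ℝ (Fin n)

theorem contDiff_one_newtonPotential (hn : n = 2 ∨ n = 3) {S : Set 𝔼} {Y : 𝔼 → ℝ}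
    (hS : Bornology.IsBounded S) (hSm : MeasurableSet S)
    (hYm : AEStronglyMeasurable Y (volume.restrict S)) {M : ℝ}
    (hM : ∀ᵐ y ∂volume.restrict S, ‖Y y‖ ≤ M) :
    ContDiff ℝ 1 (kernelPotential volume S Y fundSol) := by
  have hfd (m : ℕ) (x : 𝔼) : fderiv ℝ (regFundSol (regParam m)) x = regFundSolDeriv (regParam m) x :=
    (hasFDerivAt_regFundSol hn (by have := regParam_pos m; positivity)).fderiv
  refine contDiff_one_kernelPotential_of_tendsto (kseq := fun m => regFundSol (regParam m))
    (k' := regFundSolDeriv 0) (locallyIntegrable_fundSolMajorant hn)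
    (fun m => (contDiff_regFundSol (regParam_pos m)).of_le (by norm_cast)) (fun m => ?_)
    (fun m => ?_) ?_ ?_ hS hSm hYm hM
  · filter_upwards [ae_ne_zero hn] with x hx
    exact norm_regFundSol_le hn (regParam_pos m).le (regParam_le_one m) hx
  · filter_upwards [ae_ne_zero hn] with x hx
    exact hfd m x ▸ norm_regFundSolDeriv_le (regParam_pos m).le hx
  · filter_upwards [ae_ne_zero hn] with x hx
    exact regFundSol_zero hn ▸ tendsto_regFundSol tendsto_regParam hx
  · filter_upwards [ae_ne_zero hn] with x hx
    simp only [hfd]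
    exact tendsto_regFundSolDeriv tendsto_regParam hx

theorem fundSol_neg (x : 𝔼) : fundSol (-x) = fundSol x := by simp [fundSol]

theorem integral_fundSol_sub_mul_laplacian (hn : n = 2 ∨ n = 3) {φ : 𝔼 → ℝ}
    (hφ : ContDiff ℝ 2 φ) (hφc : HasCompactSupport φ) (y : 𝔼) :
    ∫ x, fundSol (x - y) * Δ φ x = -φ y := by
  have h1 := integral_fundSol_mul_laplacian hn (φ := fun x => φ (x + y))
    (hφ.comp (contDiff_id.add contDiff_const)) (hφc.comp_homeomorph (Homeomorph.addRight y))
  have h2 (x : 𝔼) : Δ (fun x => φ (x + y)) x = Δ φ (x + y) := by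
    simp only [InnerProductSpace.laplacian_eq_iteratedFDeriv_stdOrthonormalBasis,
      iteratedFDeriv_comp_add_right]
  simp only [h2, zero_add] at h1
  rw [← h1, ← integral_add_right_eq_self _ y]
  simp

/-- The Newtonian potential solves the Poisson equation in the sense of distributions. -/
theorem integral_newtonPotential_mul_laplacian (hn : n = 2 ∨ n = 3) {S : Set 𝔼} {Y : 𝔼 → ℝ}
    (hS : Bornology.IsBounded S) (hSm : MeasurableSet S) (hY : IntegrableOn Y S) {φ : 𝔼 → ℝ}
    (hφ : ContDiff ℝ 2 φ) (hφc : HasCompactSupport φ) :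
    ∫ x, kernelPotential volume S Y fundSol x * Δ φ x = -∫ x in S, Y x * φ x := by
  have hΔ := hφ.continuous_laplacian
  obtain ⟨C, hC⟩ := hφc.laplacian.exists_bound_of_continuous hΔ
  obtain ⟨R, hR⟩ := hφc.isCompact.isBounded.exists_norm_le
  obtain ⟨R', hR'⟩ := exists_norm_sub_le_of_isBounded hS R
  -- Γ is only locally integrable, so it is cut off to a ball that contains x - y for all x in the
  -- support of φ and all y in S. The cutoff changes nothing in the product and makes it a bounded
  -- multiple of a convolution integrand of two integrable functions, as Fubini requires.
  have hint : Integrable (fun p : 𝔼 × 𝔼 => Δ φ p.1 *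
      (S.indicator Y p.2 * (closedBall (0 : 𝔼) R').indicator fundSol (p.1 - p.2)))
      (volume.prod volume) := by
    refine Integrable.bdd_mul ?_ (hΔ.comp continuous_fst).aestronglyMeasurable
      (.of_forall fun p => hC p.1)
    exact Integrable.convolution_integrand (ContinuousLinearMap.mul ℝ ℝ)
      ((integrable_indicator_iff hSm).2 hY) ((integrable_indicator_iff measurableSet_closedBall).2
        ((locallyIntegrable_fundSol hn).integrableOn_isCompact (isCompact_closedBall 0 R')))
  have hcongr (x y : 𝔼) : Δ φ x *
      (S.indicator Y y * (closedBall (0 : 𝔼) R').indicator fundSol (x - y)) =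
      Δ φ x * (S.indicator Y y * fundSol (x - y)) := by
    by_cases hx : x ∈ tsupport φ
    · by_cases hy : y ∈ S
      · rw [indicator_of_mem (s := closedBall (0 : 𝔼) R')]
        simpa using hR' x (hR x hx) y hy
      · simp [hy]
    · simp [laplacian_eq_zero_of_notMem_tsupport hx]
  simp only [hcongr] at hint
  have hpot (x : 𝔼) : kernelPotential volume S Y fundSol x * Δ φ x =
      ∫ y, Δ φ x * (S.indicator Y y * fundSol (x - y)) := by
    rw [integral_const_mul, mul_comm, kernelPotential, ← integral_indicator hSm]
    congr 2 with y
    by_cases hy : y ∈ S <;> simp [hy]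
  simp only [hpot]
  rw [integral_integral_swap hint, ← integral_neg, ← integral_indicator hSm]
  congr 1 with y
  have h1 (x : 𝔼) : Δ φ x * (S.indicator Y y * fundSol (x - y)) =
      S.indicator Y y * (fundSol (x - y) * Δ φ x) := by ring
  simp only [h1]
  rw [integral_const_mul, integral_fundSol_sub_mul_laplacian hn hφ hφc]
  by_cases hy : y ∈ S <;> simp [hy]

/-- One derivative is put on the density. The first partial derivatives of the potential are then
Newtonian potentials of the bounded densities ∂f, hence C¹. -/
theorem contDiff_two_newtonPotential_of_contDiff (hn : n = 2 ∨ n = 3) {f : 𝔼 → ℝ}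
    (hf : ContDiff ℝ 1 f) (hfc : HasCompactSupport f) :
    ContDiff ℝ 2 (kernelPotential volume univ f fundSol) := by
  have hloc := locallyIntegrable_fundSol hn
  have hconv : kernelPotential volume univ f fundSol =
      convolution f fundSol (ContinuousLinearMap.lsmul ℝ ℝ) volume := by
    ext x
    simp [kernelPotential, convolution]
  have hder (x : 𝔼) := hfc.hasFDerivAt_convolution_left (ContinuousLinearMap.lsmul ℝ ℝ) hf hloc x
  rw [← hconv] at hder
  rw [show (2 : WithTop ℕ∞) = ((1 : ℕ) : WithTop ℕ∞) + 1 by norm_num, contDiff_succ_iff_hasFDerivAt]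
  refine ⟨_, ?_, hder⟩
  refine contDiff_clm_apply_iff.2 fun v => ?_
  have hf' : Continuous fun y => fderiv ℝ f y v :=
    (hf.continuous_fderiv one_ne_zero).clm_apply continuous_const
  have hfc' : HasCompactSupport fun y => fderiv ℝ f y v := hfc.fderiv_apply ℝ v
  obtain ⟨C, hC⟩ := hfc'.exists_bound_of_continuous hf'
  have h1 := contDiff_one_newtonPotential hn hfc'.isCompact.isBounded
    hfc'.isCompact.measurableSet hf'.aestronglyMeasurable (.of_forall hC)
  have heq (x : 𝔼) : convolution (fderiv ℝ f) fundSol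
      ((ContinuousLinearMap.lsmul ℝ ℝ).precompL 𝔼) volume x v =
      kernelPotential volume (tsupport fun y => fderiv ℝ f y v) (fun y => fderiv ℝ f y v)
        fundSol x := by
    have hex := (hfc.fderiv ℝ).convolutionExists_left
      ((ContinuousLinearMap.lsmul ℝ ℝ).precompL 𝔼 : _ →L[ℝ] ℝ →L[ℝ] _)
      (hf.continuous_fderiv one_ne_zero) hloc x
    rw [convolution_def, ContinuousLinearMap.integral_apply hex,
      kernelPotential, setIntegral_eq_integral_of_forall_compl_eq_zero]
    · rfl
    · intro y hy
      rw [image_eq_zero_of_notMem_tsupport hy, zero_smul]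
  rw [Nat.cast_one, funext heq]
  exact h1

/-- Split Y = ηY + (1 - η)Y with a bump η supported in U. The first part is a compactly supported C¹
density. For x near x₀ the second part only sees Γ away from its singularity, so Γ may be replaced
there by the C² kernel (1 - χ)Γ. -/
theorem exists_contDiff_two_eventuallyEq_newtonPotential (hn : n = 2 ∨ n = 3) {S U : Set 𝔼}
    {Y : 𝔼 → ℝ} (hS : Bornology.IsBounded S) (hSm : MeasurableSet S)
    (hYm : AEStronglyMeasurable Y (volume.restrict S)) {M : ℝ}
    (hM : ∀ᵐ y ∂volume.restrict S, ‖Y y‖ ≤ M) (hU : IsOpen U) (hUS : U ⊆ S)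
    (hYU : ContDiffOn ℝ 1 Y U) {x₀ : 𝔼} (hx₀ : x₀ ∈ U) :
    ∃ V : 𝔼 → ℝ, ContDiff ℝ 2 V ∧ kernelPotential volume S Y fundSol =ᶠ[𝓝 x₀] V := by
  obtain ⟨r, hr, hrU⟩ := Metric.nhds_basis_closedBall.mem_iff.1 (hU.mem_nhds hx₀)
  -- The radii fit together: if ‖x - x₀‖ < r/4 and 1 - η(y) ≠ 0, then ‖y - x₀‖ > r/2, so ‖x - y‖ >
  -- r/4 and χ(x - y) = 0.
  let η : ContDiffBump x₀ := ⟨r / 2, r, by positivity, by linarith⟩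
  let χ : ContDiffBump (0 : 𝔼) := ⟨r / 8, r / 4, by positivity, by linarith⟩
  have hηU : tsupport η ⊆ U := by rw [η.tsupport_eq]; exact hrU
  have hf : ContDiff ℝ 1 fun y => η y * Y y := by
    refine contDiff_iff_contDiffAt.2 fun y => ?_
    by_cases hy : y ∈ U
    · exact η.contDiff.contDiffAt.mul (hYU.contDiffAt (hU.mem_nhds hy))
    · have h1 : (η : 𝔼 → ℝ) =ᶠ[𝓝 y] 0 :=
        notMem_tsupport_iff_eventuallyEq.1 fun h => hy (hηU h)
      refine (contDiffAt_const (c := (0 : ℝ))).congr_of_eventuallyEq ?_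
      filter_upwards [h1] with z hz
      simp [hz]
  have hfc : HasCompactSupport fun y => η y * Y y := η.hasCompactSupport.mul_right
  have hK : ContDiff ℝ (2 : ℕ) fun z : 𝔼 => (1 - χ z) * fundSol z := by
    refine contDiff_iff_contDiffAt.2 fun z => ?_
    by_cases hz : z = 0
    · subst hz
      refine (contDiffAt_const (c := (0 : ℝ))).congr_of_eventuallyEq ?_
      filter_upwards [χ.eventuallyEq_one] with z hz
      simp [hz]
    · exact (contDiffAt_const.sub χ.contDiff.contDiffAt).mul (harmonicAt_fundSol hn hz).1
  have hfin : IsFiniteMeasure (volume.restrict S) := ⟨by simpa using hS.measure_lt_top⟩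
  have hY : IntegrableOn Y S := Integrable.of_bound hYm M hM
  have hYη : IntegrableOn (fun y => (1 - η y) * Y y) S :=
    Integrable.bdd_mul (c := 1) hY (continuous_const.sub η.continuous).aestronglyMeasurable
      (.of_forall fun y => by
        rw [Real.norm_eq_abs, abs_le]
        constructor <;> linarith [η.le_one (x := y), η.nonneg (x := y)])
  refine ⟨_, (contDiff_two_newtonPotential_of_contDiff hn hf hfc).add
    (contDiff_kernelPotential hK hS hSm hYη), ?_⟩
  filter_upwards [ball_mem_nhds x₀ (show 0 < r / 4 by positivity)] with x hx
  have hloc := locallyIntegrable_fundSol hn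
  have e1 : kernelPotential volume univ (fun y => η y * Y y) fundSol x =
      ∫ y in S, (η y * Y y) • fundSol (x - y) := by
    rw [kernelPotential, setIntegral_univ, setIntegral_eq_integral_of_forall_compl_eq_zero]
    intro y hy
    rw [image_eq_zero_of_notMem_tsupport fun h => hy (hUS (hηU h))]
    simp
  have e2 (y : 𝔼) : ((1 - η y) * Y y) • ((1 - χ (x - y)) * fundSol (x - y)) =
      Y y • fundSol (x - y) - (η y * Y y) • fundSol (x - y) := by
    by_cases hy : dist y x₀ ≤ r / 2
    · rw [η.one_of_mem_closedBall hy]; simp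
    · have h1 : r / 4 ≤ dist (x - y) 0 := by
        have h2 := dist_triangle y x x₀
        have h3 : dist x x₀ < r / 4 := hx
        rw [dist_zero_right, ← dist_eq_norm, dist_comm]
        linarith
      rw [χ.zero_of_le_dist h1]
      simp; ring
  have i1 : IntegrableOn (fun y => Y y • fundSol (x - y)) S :=
    integrableOn_smul_const_sub hloc hS hSm hYm hM x
  have i2 : IntegrableOn (fun y => (η y * Y y) • fundSol (x - y)) S := by
    refine (Integrable.bdd_mul (c := 1) i1 η.continuous.aestronglyMeasurable
      (.of_forall fun y => ?_)).congr (.of_forall fun y => ?_)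
    · rw [Real.norm_of_nonneg η.nonneg]; exact η.le_one
    · simp [mul_assoc]
  rw [e1]
  simp only [kernelPotential, e2]
  rw [integral_sub i1 i2]
  ring

/-- Near x₀ the potential agrees with a C² function V. Testing the distributional equation against
bumps in a small ball gives ΔV + Y = 0 almost everywhere there, hence everywhere there by
continuity. -/
theorem laplacian_newtonPotential (hn : n = 2 ∨ n = 3) {S U : Set 𝔼}
    {Y : 𝔼 → ℝ} (hS : Bornology.IsBounded S) (hSm : MeasurableSet S)
    (hYm : AEStronglyMeasurable Y (volume.restrict S)) {M : ℝ}
    (hM : ∀ᵐ y ∂volume.restrict S, ‖Y y‖ ≤ M) (hU : IsOpen U) (hUS : U ⊆ S)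
    (hYU : ContDiffOn ℝ 1 Y U) {x₀ : 𝔼} (hx₀ : x₀ ∈ U) :
    Δ (kernelPotential volume S Y fundSol) x₀ = -Y x₀ := by
  obtain ⟨V, hV, hWV⟩ :=
    exists_contDiff_two_eventuallyEq_newtonPotential hn hS hSm hYm hM hU hUS hYU hx₀
  rw [(InnerProductSpace.laplacian_congr_nhds hWV).eq_of_nhds]
  obtain ⟨r, hr, hball⟩ := Metric.eventually_nhds_iff_ball.1 (hWV.and (hU.mem_nhds hx₀))
  have hfin : IsFiniteMeasure (volume.restrict S) := ⟨by simpa using hS.measure_lt_top⟩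
  have hY : IntegrableOn Y S := Integrable.of_bound hYm M hM
  have hBU : ball x₀ r ⊆ U := fun x hx => (hball x hx).2
  have hc : ContinuousOn (fun x => Δ V x + Y x) (ball x₀ r) :=
    hV.continuous_laplacian.continuousOn.add (hYU.continuousOn.mono hBU)
  have hae : ∀ᵐ x : 𝔼, x ∈ ball x₀ r → Δ V x + Y x = 0 := by
    refine isOpen_ball.ae_eq_zero_of_integral_contDiff_smul_eq_zero
      (hc.locallyIntegrableOn measurableSet_ball) fun φ hφ hφc hφs => ?_
    have hφ2 : ContDiff ℝ 2 φ := hφ.of_le (by norm_cast)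
    have hφS (x : 𝔼) (hx : x ∉ S) : φ x = 0 :=
      image_eq_zero_of_notMem_tsupport fun h => hx (hUS (hBU (hφs h)))
    obtain ⟨C, hC⟩ := hφc.exists_bound_of_continuous hφ.continuous
    have i1 : Integrable fun x => Δ V x * φ x :=
      (hV.continuous_laplacian.mul hφ.continuous).integrable_of_hasCompactSupport hφc.mul_left
    have i2 : Integrable fun x => Y x * φ x := by
      refine (integrableOn_iff_integrable_of_support_subset (s := S) fun x hx => ?_).1
        (Integrable.mul_bdd (c := C) hY hφ.continuous.aestronglyMeasurable (.of_forall hC))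
      by_contra h
      exact hx (by simp [hφS x h])
    have e1 : ∫ x, Δ V x * φ x = -∫ x, Y x * φ x := by
      rw [← integral_mul_laplacian_eq hV hφ2 hφc,
        ← setIntegral_eq_integral_of_forall_compl_eq_zero (s := S) (f := fun x => Y x * φ x)
          fun x hx => by simp [hφS x hx],
        ← integral_newtonPotential_mul_laplacian hn hS hSm hY hφ2 hφc]
      congr 1 with x
      by_cases hx : x ∈ tsupport φ
      · rw [(hball x (hφs hx)).1]
      · simp [laplacian_eq_zero_of_notMem_tsupport hx]
    have e2 (x : 𝔼) : φ x • (Δ V x + Y x) = Δ V x * φ x + Y x * φ x := by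
      simp; ring
    simp only [e2]
    rw [integral_add i1 i2, e1]
    simp
  have h0 := Measure.eqOn_open_of_ae_eq (μ := volume)
    ((ae_restrict_iff' measurableSet_ball).2 hae) isOpen_ball hc continuousOn_const
    (mem_ball_self hr)
  linarith [show Δ V x₀ + Y x₀ = 0 from h0]

end NewtonPotential

/-! ### Geometry at a C² boundary point -/

section Boundary

variable {n : ℕ} {Ω U : Set (EuclideanSpace ℝ (Fin n))} {x : EuclideanSpace ℝ (Fin n)}
  {ρ : EuclideanSpace ℝ (Fin n) → ℝ}

local notation "𝔼" => EuclideanSpace ℝ (Fin n)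

theorem tendsto_add_smul_zero (x ν : 𝔼) : Tendsto (fun t : ℝ => x + t • ν) (𝓝 0) (𝓝 x) := by
  have h : Continuous fun t : ℝ => x + t • ν := by fun_prop
  simpa using h.tendsto 0

namespace IsC2DefiningFunction

theorem hasDerivAt_normal (h : IsC2DefiningFunction Ω x U ρ) :
    HasDerivAt (fun t : ℝ => ρ (x + t • (‖gradient ρ x‖⁻¹ • gradient ρ x))) ‖gradient ρ x‖ 0 := by
  have hd : DifferentiableAt ℝ ρ x :=
    (h.contDiffOn.contDiffAt (h.isOpen.mem_nhds h.mem)).differentiableAt two_ne_zero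
  have h1 := hd.hasGradientAt.hasFDerivAt
  set ν := ‖gradient ρ x‖⁻¹ • gradient ρ x with hν
  have h2 : HasDerivAt (fun t : ℝ => x + t • ν) ν 0 := by
    simpa using ((hasDerivAt_id (0 : ℝ)).smul_const ν).const_add x
  have h3 : HasFDerivAt ρ (InnerProductSpace.toDual ℝ 𝔼 (gradient ρ x)) (x + (0 : ℝ) • ν) := by
    simpa using h1
  convert! h3.comp_hasDerivAt (0 : ℝ) h2 using 1
  have h0 : ‖gradient ρ x‖ ≠ 0 := norm_ne_zero_iff.2 h.gradient_ne_zero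
  rw [InnerProductSpace.toDual_apply_apply, hν, inner_smul_right, real_inner_self_eq_norm_sq]
  field_simp

/-- Along the normal, ρ vanishes at t = 0 with positive derivative, so it is negative for small t <
0. -/
theorem eventually_mem (h : IsC2DefiningFunction Ω x U ρ) :
    ∀ᶠ t : ℝ in 𝓝[<] 0, x + t • (‖gradient ρ x‖⁻¹ • gradient ρ x) ∈ Ω := by
  have h0 : 0 < ‖gradient ρ x‖ := norm_pos_iff.2 h.gradient_ne_zero
  have hU := (tendsto_add_smul_zero x (‖gradient ρ x‖⁻¹ • gradient ρ x)).eventually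
    (h.isOpen.mem_nhds h.mem)
  have hs := (hasDerivAt_iff_tendsto_slope.1 h.hasDerivAt_normal).eventually (lt_mem_nhds h0)
  filter_upwards [hs.filter_mono (nhdsWithin_mono 0 fun t (ht : t < 0) => ht.ne),
    hU.filter_mono nhdsWithin_le_nhds, self_mem_nhdsWithin] with t h1 h2 (h3 : t < 0)
  have h4 : x + t • (‖gradient ρ x‖⁻¹ • gradient ρ x) ∈ Ω ∩ U := by
    rw [h.inter_eq]
    refine ⟨h2, ?_⟩
    simp only [slope_def_field, zero_smul, add_zero, h.apply_eq_zero, sub_zero] at h1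
    exact (div_pos_iff.1 h1).elim (fun h => absurd h.2 h3.not_gt) fun h => h.1
  exact h4.1

/-- On the outer side of the normal ρ is positive. The set where ρ > 0 in U is open and disjoint
from Ω, so these points miss the closure as well. This rules out a domain lying on both sides of its
boundary. -/
theorem mem_closure_compl_closure (h : IsC2DefiningFunction Ω x U ρ) :
    x ∈ closure (closure Ω)ᶜ := by
  have h0 : 0 < ‖gradient ρ x‖ := norm_pos_iff.2 h.gradient_ne_zero
  have hT := tendsto_add_smul_zero x (‖gradient ρ x‖⁻¹ • gradient ρ x)
  have hU := hT.eventually (h.isOpen.mem_nhds h.mem)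
  have hs := (hasDerivAt_iff_tendsto_slope.1 h.hasDerivAt_normal).eventually (lt_mem_nhds h0)
  refine mem_closure_of_tendsto (hT.mono_left (nhdsWithin_le_nhds (s := Ioi 0))) ?_
  filter_upwards [hs.filter_mono (nhdsWithin_mono 0 fun t (ht : 0 < t) => ht.ne'),
    hU.filter_mono nhdsWithin_le_nhds, self_mem_nhdsWithin] with t h1 h2 (h3 : 0 < t)
  simp only [slope_def_field, zero_smul, add_zero, h.apply_eq_zero, sub_zero] at h1
  have h4 := (div_pos_iff.1 h1).elim (fun h => h.1) fun h => absurd h.2 h3.not_gt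
  have hopen : IsOpen (U ∩ ρ ⁻¹' Ioi 0) := h.contDiffOn.continuousOn.isOpen_inter_preimage
    h.isOpen isOpen_Ioi
  intro hcl
  obtain ⟨y, ⟨hyU, hy⟩, hyΩ⟩ := mem_closure_iff.1 hcl _ hopen ⟨h2, h4⟩
  have hyU' : y ∈ {y ∈ U | ρ y < 0} := h.inter_eq ▸ ⟨hyΩ, hyU⟩
  exact lt_asymm hy hyU'.2

end IsC2DefiningFunction

end Boundary

/-! ### Orthogonality to harmonic functions -/

section NullSpace

variable {n : ℕ} {Ω : Set (EuclideanSpace ℝ (Fin n))} {Y : EuclideanSpace ℝ (Fin n) → ℝ}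

local notation "𝔼" => EuclideanSpace ℝ (Fin n)

theorem exists_ae_bound_of_mem_nullSpace (hY : Y ∈ nullSpace Ω) :
    ∃ M : ℝ, ∀ᵐ y ∂volume.restrict Ω, ‖Y y‖ ≤ M := by
  refine ⟨(eLpNorm Y ⊤ (volume.restrict Ω)).toReal, ?_⟩
  filter_upwards [ae_le_eLpNormEssSup (f := Y) (μ := volume.restrict Ω)] with y hy
  rw [← eLpNorm_exponent_top] at hy
  rw [← toReal_enorm]
  exact ENNReal.toReal_mono hY.1.2.ne hy

/-- The pole of Γ(x - ·) lies off the closure of Ω, so this function is an admissible test function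
in the definition of the null space. -/
theorem newtonPotential_eq_zero (hn : n = 2 ∨ n = 3) (hY : Y ∈ nullSpace Ω) {x : 𝔼}
    (hx : x ∉ closure Ω) : kernelPotential volume Ω Y fundSol x = 0 := by
  have hharm : ∀ y ∈ closure Ω, InnerProductSpace.HarmonicAt (fun y => fundSol (x - y)) y := by
    intro y hy
    have hne : y - x ≠ 0 := sub_ne_zero.2 fun h => hx (h ▸ hy)
    have e : (fun y => fundSol (x - y)) = fun y : 𝔼 => fundSol (y + -x) := by
      ext y; rw [← fundSol_neg]; congr 1; abel
    have h1 := harmonicAt_fundSol hn hne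
    rw [e]
    refine ⟨ContDiffAt.comp (g := fundSol) y (by simpa [sub_eq_add_neg] using h1.1)
      (contDiffAt_id.add contDiffAt_const), ?_⟩
    have h2 (z : 𝔼) : Δ (fun y : 𝔼 => fundSol (y + -x)) z = Δ (fundSol (n := n)) (z + -x) := by
      simp only [InnerProductSpace.laplacian_eq_iteratedFDeriv_stdOrthonormalBasis,
        iteratedFDeriv_comp_add_right]
    have h3 : Tendsto (fun z => z + -x) (𝓝 y) (𝓝 (y - x)) := by
      rw [sub_eq_add_neg]
      exact (continuous_id.add continuous_const).tendsto y
    filter_upwards [h3.eventually h1.2] with z hz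
    rw [h2, hz]; rfl
  have h := hY.2 (fun y => fundSol (x - y)) (fun y hy => hharm y (subset_closure hy))
    fun y hy => (hharm y hy).1.continuousAt.continuousWithinAt
  rw [← h, kernelPotential]
  simp only [smul_eq_mul, mul_comm]

/-- On `Ω`, a kernel of the form `Γ(x - y) + h(y)` with `h` harmonic integrates an element of the
null space to its Newtonian potential. -/
theorem integral_green_mul_eq_newtonPotential (hn : n = 2 ∨ n = 3) (hΩ : IsOpen Ω)
    (hb : Bornology.IsBounded Ω) (hY : Y ∈ nullSpace Ω) {x : 𝔼} {g h : 𝔼 → ℝ}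
    (hh : InnerProductSpace.HarmonicOnNhd h Ω) (hc : ContinuousOn h (closure Ω))
    (hg : ∀ y ∈ closure Ω, y ≠ x → g y = fundSol (x - y) + h y) :
    IntegrableOn (fun y => g y * Y y) Ω ∧
      ∫ y in Ω, g y * Y y = kernelPotential volume Ω Y fundSol x := by
  obtain ⟨M, hM⟩ := exists_ae_bound_of_mem_nullSpace hY
  have hfin : IsFiniteMeasure (volume.restrict Ω) := ⟨by simpa using hb.measure_lt_top⟩
  have hYi : IntegrableOn Y Ω := Integrable.of_bound hY.1.1 M hM
  have i1 : IntegrableOn (fun y => Y y • fundSol (x - y)) Ω :=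
    integrableOn_smul_const_sub (locallyIntegrable_fundSol hn) hb hΩ.measurableSet hY.1.1 hM x
  obtain ⟨C, hC⟩ := hb.isCompact_closure.exists_bound_of_continuousOn hc
  have i2 : IntegrableOn (fun y => h y * Y y) Ω := by
    refine Integrable.bdd_mul (c := C) hYi
      ((hc.mono subset_closure).aestronglyMeasurable hΩ.measurableSet) ?_
    filter_upwards [ae_restrict_mem hΩ.measurableSet] with y hy using hC y (subset_closure hy)
  have hae : (fun y => Y y • fundSol (x - y) + h y * Y y) =ᵐ[volume.restrict Ω]
      fun y => g y * Y y := by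
    have := nontrivial_of_dim hn
    filter_upwards [ae_restrict_mem hΩ.measurableSet,
      ae_restrict_of_ae (Measure.ae_ne volume x)] with y hy hyx
    rw [hg y (subset_closure hy) hyx, smul_eq_mul]
    ring
  refine ⟨(i1.add i2).congr hae, ?_⟩
  rw [← integral_congr_ae hae, integral_add i1 i2, hY.2 h hh hc, add_zero, kernelPotential]

/-- The potential and its derivative are continuous on the whole space and vanish on the open
exterior. Their zero sets are closed, so they contain every limit of exterior points. -/
theorem newtonPotential_frontier (hn : n = 2 ∨ n = 3) (hΩ : IsBoundedC2Domain Ω)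
    (hY : Y ∈ nullSpace Ω) {x : 𝔼} (hx : x ∈ frontier Ω) :
    kernelPotential volume Ω Y fundSol x = 0 ∧
      fderiv ℝ (kernelPotential volume Ω Y fundSol) x = 0 := by
  obtain ⟨M, hM⟩ := exists_ae_bound_of_mem_nullSpace hY
  have hW := contDiff_one_newtonPotential hn hΩ.isBounded hΩ.isOpen.measurableSet hY.1.1 hM
  obtain ⟨U, ρ, hρ⟩ := hΩ.exists_defining x hx
  have hxc := hρ.mem_closure_compl_closure
  constructor
  · refine closure_minimal (t := kernelPotential volume Ω Y fundSol ⁻¹' {0})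
      (fun y hy => newtonPotential_eq_zero hn hY hy) (isClosed_singleton.preimage hW.continuous) hxc
  · refine closure_minimal (t := fderiv ℝ (kernelPotential volume Ω Y fundSol) ⁻¹' {0})
      (fun y hy => ?_)
      (isClosed_singleton.preimage (hW.continuous_fderiv one_ne_zero)) hxc
    have h1 : kernelPotential volume Ω Y fundSol =ᶠ[𝓝 y] fun _ => 0 := by
      filter_upwards [isClosed_closure.isOpen_compl.mem_nhds hy] with z hz
      exact newtonPotential_eq_zero hn hY hz
    simp [h1.fderiv_eq]

/-- Inside Ω the regular part integrates to zero against Y. On the boundary both sides vanish, but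
for different reasons: one by the boundary condition on the kernel, the other by continuity from the
exterior. -/
theorem greenPotential_eqOn (hn : n = 2 ∨ n = 3) (hΩ : IsBoundedC2Domain Ω)
    (hY : Y ∈ nullSpace Ω) {GD : 𝔼 → 𝔼 → ℝ} (hGD : IsDirichletGreen Ω GD) :
    EqOn (greenPotential Ω GD Y) (kernelPotential volume Ω Y fundSol) (closure Ω) := by
  intro x hx
  rw [closure_eq_self_union_frontier] at hx
  rcases hx with hx | hx
  · obtain ⟨h, hh, hc, hg⟩ := hGD.regular_part x hx
    exact (integral_green_mul_eq_newtonPotential hn hΩ.isOpen hΩ.isBounded hY hh hc hg).2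
  · rw [(newtonPotential_frontier hn hΩ hY hx).1, greenPotential,
      setIntegral_congr_fun (g := fun _ => 0) hΩ.isOpen.measurableSet fun y hy => by
        simp [hGD.left_boundary x hx y hy]]
    simp

theorem hasNormalDerivAt_zero_of_eqOn {u w : 𝔼 → ℝ} (huw : EqOn u w (closure Ω)) {x : 𝔼}
    (hx : x ∈ frontier Ω) (hw : HasFDerivAt w (0 : 𝔼 →L[ℝ] ℝ) x) :
    HasNormalDerivAt Ω u 0 x := by
  rintro ν ⟨U, ρ, hρ, rfl⟩
  set ν := ‖gradient ρ x‖⁻¹ • gradient ρ x with hν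
  have h1 : HasDerivAt (fun t : ℝ => x + t • ν) ν 0 := by
    simpa using ((hasDerivAt_id (0 : ℝ)).smul_const ν).const_add x
  have h2 : HasFDerivAt w (0 : 𝔼 →L[ℝ] ℝ) (x + (0 : ℝ) • ν) := by simpa using hw
  have h3 := (h2.comp_hasDerivAt (0 : ℝ) h1).hasDerivWithinAt (s := Iic 0)
  have hx0 : u (x + (0 : ℝ) • ν) = w (x + (0 : ℝ) • ν) := by
    simpa using huw (frontier_subset_closure hx)
  refine HasDerivWithinAt.congr_of_eventuallyEq h3 ?_ hx0
  -- The two functions agree only on the closure, so the one-sided difference quotient must be seen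
  -- to stay there.
  have h4 : ∀ᶠ t : ℝ in 𝓝[≤] 0, t < 0 → x + t • ν ∈ Ω := by
    have := eventually_nhdsWithin_iff.1 hρ.eventually_mem
    exact this.filter_mono nhdsWithin_le_nhds
  filter_upwards [h4, self_mem_nhdsWithin] with t ht (ht0 : t ≤ 0)
  rcases ht0.lt_or_eq with h | rfl
  · exact huw (subset_closure (ht h))
  · exact hx0

theorem isC1OnClosure_of_eqOn (hΩ : IsOpen Ω) {u w : 𝔼 → ℝ} (huw : EqOn u w (closure Ω))
    (hw : ContDiff ℝ 1 w) : IsC1OnClosure Ω u := by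
  refine ⟨hw.continuous.continuousOn.congr huw, gradient w, ?_, fun x hx => ?_⟩
  · exact ((InnerProductSpace.toDual ℝ 𝔼).symm.continuous.comp
      (hw.continuous_fderiv one_ne_zero)).continuousOn
  · refine HasGradientAt.congr_of_eventuallyEq
      (hw.differentiable one_ne_zero x).hasGradientAt ?_
    filter_upwards [hΩ.mem_nhds hx] with y hy using huw (subset_closure hy)

end NullSpace

/-! ### Transfer from the Newtonian potential to the Green potentials -/

theorem mainTheorem4 {n : ℕ} (hn : n = 2 ∨ n = 3) (Ω : Set (EuclideanSpace ℝ (Fin n)))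
    (hΩ : IsBoundedC2Domain Ω)
    (GD : EuclideanSpace ℝ (Fin n) → EuclideanSpace ℝ (Fin n) → ℝ) (hGD : IsDirichletGreen Ω GD)
    (Y : EuclideanSpace ℝ (Fin n) → ℝ) (hY : Y ∈ nullSpace Ω) :
    -- the integral defining the potential converges and gives a function in `C¹(closure Ω)`
    (∀ x ∈ closure Ω, IntegrableOn (fun y => GD x y * Y y) Ω) ∧
    IsC1OnClosure Ω (greenPotential Ω GD Y) ∧
    -- (i) the Poisson equation, in the sense of distributions, and pointwise where `Y` is `C¹`
    (∀ φ : EuclideanSpace ℝ (Fin n) → ℝ, ContDiff ℝ ∞ φ → HasCompactSupport φ → tsupport φ ⊆ Ω →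
      ∫ x in Ω, greenPotential Ω GD Y x * Δ φ x = -∫ x in Ω, Y x * φ x) ∧
    (∀ U : Set (EuclideanSpace ℝ (Fin n)), IsOpen U → U ⊆ Ω → ContDiffOn ℝ 1 Y U →
      ContDiffOn ℝ 2 (greenPotential Ω GD Y) U ∧
        ∀ x ∈ U, Δ (greenPotential Ω GD Y) x = -Y x) ∧
    -- (ii) zero boundary values
    (∀ x ∈ frontier Ω, greenPotential Ω GD Y x = 0) ∧
    -- (iii) zero normal derivative
    (∀ x ∈ frontier Ω, HasNormalDerivAt Ω (greenPotential Ω GD Y) 0 x) ∧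
    -- the representation through the Neumann Green's function, so `𝒦 Y = 0`
    (∀ GN : EuclideanSpace ℝ (Fin n) → EuclideanSpace ℝ (Fin n) → ℝ, IsNeumannGreen Ω GN →
      ∀ x ∈ Ω, IntegrableOn (fun y => GN x y * Y y) Ω ∧
        greenPotential Ω GD Y x = greenPotential Ω GN Y x ∧
        ∫ y in Ω, greenDiff GD GN x y * Y y = 0) := by
  obtain ⟨M, hM⟩ := exists_ae_bound_of_mem_nullSpace hY
  have hm := hΩ.isOpen.measurableSet
  have hfin : IsFiniteMeasure (volume.restrict Ω) := ⟨by simpa using hΩ.isBounded.measure_lt_top⟩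
  have hYi : IntegrableOn Y Ω := Integrable.of_bound hY.1.1 M hM
  have hW := contDiff_one_newtonPotential hn hΩ.isBounded hm hY.1.1 hM
  have hEq := greenPotential_eqOn hn hΩ hY hGD
  have hEv {x : EuclideanSpace ℝ (Fin n)} (hx : x ∈ Ω) :
      greenPotential Ω GD Y =ᶠ[𝓝 x] kernelPotential volume Ω Y fundSol := by
    filter_upwards [hΩ.isOpen.mem_nhds hx] with y hy using hEq (subset_closure hy)
  have hint : ∀ x ∈ Ω, IntegrableOn (fun y => GD x y * Y y) Ω := fun x hx => by
    obtain ⟨h, hh, hc, hg⟩ := hGD.regular_part x hx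
    exact (integral_green_mul_eq_newtonPotential hn hΩ.isOpen hΩ.isBounded hY hh hc hg).1
  refine ⟨fun x hx => ?_, isC1OnClosure_of_eqOn hΩ.isOpen hEq hW, fun φ hφ hφc hφs => ?_,
    fun U hU hUΩ hYU => ⟨fun x hx => ?_, fun x hx => ?_⟩, fun x hx => ?_, fun x hx => ?_,
    fun GN hGN x hx => ?_⟩
  · rw [closure_eq_self_union_frontier] at hx
    rcases hx with hx | hx
    · exact hint x hx
    · exact integrableOn_zero.congr_fun
        (fun y hy => by simp [hGD.left_boundary x hx y hy]) hm
  · rw [← integral_newtonPotential_mul_laplacian hn hΩ.isBounded hm hYi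
      (hφ.of_le (by norm_cast)) hφc,
      ← setIntegral_eq_integral_of_forall_compl_eq_zero (s := Ω)
        (f := fun x => kernelPotential volume Ω Y fundSol x * Δ φ x) fun x hx => by
        rw [laplacian_eq_zero_of_notMem_tsupport fun h => hx (hφs h), mul_zero]]
    exact setIntegral_congr_fun hm fun x hx => by simp only [hEq (subset_closure hx)]
  · obtain ⟨V, hV, hWV⟩ := exists_contDiff_two_eventuallyEq_newtonPotential hn hΩ.isBounded hm
      hY.1.1 hM hU hUΩ hYU hx
    exact (hV.contDiffAt.congr_of_eventuallyEq ((hEv (hUΩ hx)).trans hWV)).contDiffWithinAt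
  · rw [(InnerProductSpace.laplacian_congr_nhds (hEv (hUΩ hx))).eq_of_nhds]
    exact laplacian_newtonPotential hn hΩ.isBounded hm hY.1.1 hM hU hUΩ hYU hx
  · rw [hEq (frontier_subset_closure hx)]
    exact (newtonPotential_frontier hn hΩ hY hx).1
  · refine hasNormalDerivAt_zero_of_eqOn hEq hx ?_
    rw [← (newtonPotential_frontier hn hΩ hY hx).2]
    exact (hW.differentiable one_ne_zero x).hasFDerivAt
  · obtain ⟨h, hh, hc, hg⟩ := hGN.regular_part x hx
    have hN := integral_green_mul_eq_newtonPotential hn hΩ.isOpen hΩ.isBounded hY hh hc.1 hg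
    have hDN : greenPotential Ω GD Y x = greenPotential Ω GN Y x :=
      (hEq (subset_closure hx)).trans hN.2.symm
    refine ⟨hN.1, hDN, ?_⟩
    simp only [greenDiff, sub_mul]
    rw [integral_sub (hint x hx) hN.1]
    exact sub_eq_zero.2 hDN

end
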